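/- Let $d\in\mathbb N$, let $(\Omega,\mathcal F,\mathbb P)$ be a probability space, $\Xi$ a measurable space, $\xi:\Omega\to\Xi$ a random variable, and $f:\mathbb R^d\times\Xi\to\mathbb R$ a measurable map such that $f(\cdot,s)$ is differentiable for every $s\in\Xi$; write $\nabla f(x,s)$ for its gradient in $x$. Let $\|\cdot\|$ be the Euclidean norm; products, squares, quotients, square roots and inequalities of vectors are taken componentwise. Assume the following. 1. For almost every $\xi$, $f(\cdot,\xi)$ is continuously differentiable; there is $y\in\mathbb R^d$ with $\mathbb E|f(y,\xi)|<\infty$ and $\mathbb E\|\nabla f(y,\xi)\|^2<\infty$; and for every compact $K\subset\mathbb R^d$ there is $L_K>0$ such that $\mathbb E\|\nabla f(x,\xi)-\nabla f(x',\xi)\|^2\le L_K^2\|x-x'\|^2$ for all $x,x'\in K$. Put $F(x)=\mathbb E f(x,\xi)$ and $S(x)=\mathbb E[\nabla f(x,\xi)^{\odot 2}]$ (componentwise square). 2. $F$ is coercive: $F(x)\to+\infty$ as $\|x\|\to\infty$. 3. $S(x)>0$ for every $x\in\mathbb R^d$. 4. $\bar\alpha,\bar\beta:[0,\infty)\to[0,1)$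 are functions for which the limits $a=\lim_{\gamma\downarrow0}(1-\bar\alpha(\gamma))/\gamma$ and $b=\lim_{\gamma\downarrow0}(1-\bar\beta(\gamma))/\gamma$ exist, with $a>0$, $b>0$ and $b\le 4a$. Moreover $\varepsilon>0$. For $y\in\mathbb R^d$, a number $\theta\in(0,\frac12]$ is called a Łojasiewicz exponent of $F$ at $y$ if there are $c,\sigma>0$ such that $\|\nabla F(x)\|\ge c\,|F(x)-F(y)|^{1-\theta}$ for all $x$ with $\|x-y\|\le\sigma$. Let $\mathcal S=\{x:\nabla F(x)=0\}$ be the set of critical points of $F$. 5. $F$ has a Łojasiewicz exponent at every point of $\mathcal S$, and $F(\mathcal S)$ has empty interior. Let $x_0\in\mathbb R^d$ and let $z(t)=(x(t),m(t),v(t))$ be the global solution with initial condition $(x_0,0,0)$ of the ODE $$\dot x=-\frac{(1-e^{-at})^{-1}m}{\varepsilon+\sqrt{(1-e^{-bt})^{-1}v}},\qquad \dot m=a(\nabla F(x)-m),\qquad \dot v=b(S(x)-v),$$ that is, $z:[0,\infty)\to\mathbb R^d\times\mathbb R^d\times[0,\infty)^d$ is continuous, continuously differentiable on $(0,\infty)$,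 satisfies the ODE for all $t>0$, and $z(0)=(x_0,0,0)$. Then there exists $x^*\in\mathcal S$ such that $x(t)\to x^*$ as $t\to+\infty$. Moreover, if $\theta\in(0,\frac12]$ is a Łojasiewicz exponent of $F$ at $x^*$, then: - if $\theta<\frac12$, there is $C>0$ such that $\|x(t)-x^*\|\le C\,t^{-\frac{\theta}{1-2\theta}}$ for all $t>0$; - if $\theta=\frac12$, there are $C>0$ and $\delta>0$ such that $\|x(t)-x^*\|\le C\,e^{-\delta t}$ for all $t\ge0$. -/

import Mathlib

open Set Filter Topology MeasureTheory
open scoped NNReal ENNReal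

namespace Adam

/-- `ℝ^d` with its Euclidean norm. -/
abbrev Vec (d : ℕ) : Type := EuclideanSpace ℝ (Fin d)

noncomputable section

/-- The gradient `∇f(x, s)` of `f` with respect to its first variable. -/
def gradx {d : ℕ} {Ξ : Type*} (f : Vec d → Ξ → ℝ) (x : Vec d) (s : Ξ) : Vec d :=
  gradient (fun y => f y s) x

/-- The objective function `F(x) = E(f(x, ξ))`. -/
def objective {d : ℕ} {Ω Ξ : Type*} [MeasurableSpace Ω] (P : Measure Ω) (ξ : Ω → Ξ)
    (f : Vec d → Ξ → ℝ) (x : Vec d) : ℝ :=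
  ∫ ω, f x (ξ ω) ∂P

/-- The vector of second moments `S(x) = E(∇f(x, ξ)^{⊙2})`. -/
def secondMoment {d : ℕ} {Ω Ξ : Type*} [MeasurableSpace Ω] (P : Measure Ω) (ξ : Ω → Ξ)
    (f : Vec d → Ξ → ℝ) (x : Vec d) : Vec d :=
  WithLp.toLp 2 fun i => ∫ ω, (gradx f x (ξ ω) i) ^ 2 ∂P

/-- The assumptions on the random function `f(·, ξ)`. -/
structure RegularModel {d : ℕ} {Ω Ξ : Type*} [MeasurableSpace Ω] [MeasurableSpace Ξ]
    (P : Measure Ω) (ξ : Ω → Ξ) (f : Vec d → Ξ → ℝ) : Prop where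
  /-- `f` is measurable on `ℝ^d × Ξ`; in particular every `f(x, ·)` is measurable. -/
  measurable : Measurable (Function.uncurry f)
  /-- `f(·, s)` is differentiable for every `s`. -/
  differentiable : ∀ s, Differentiable ℝ fun x => f x s
  /-- For almost every `ξ`, `f(·, ξ)` is continuously differentiable. -/
  contDiff : ∀ᵐ ω ∂P, ContDiff ℝ 1 fun x => f x (ξ ω)
  /-- At some point, `f` is integrable and its gradient is square integrable. -/
  moments : ∃ y : Vec d, ∫⁻ ω, ‖f y (ξ ω)‖ₑ ∂P < ∞ ∧ ∫⁻ ω, ‖gradx f y (ξ ω)‖ₑ ^ 2 ∂P < ∞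
  /-- On compact sets, the gradient is Lipschitz continuous in the `L²` sense. -/
  lipschitz : ∀ K : Set (Vec d), IsCompact K → ∃ L : ℝ, 0 < L ∧ ∀ x ∈ K, ∀ y ∈ K,
    ∫⁻ ω, ‖gradx f x (ξ ω) - gradx f y (ξ ω)‖ₑ ^ 2 ∂P ≤ ENNReal.ofReal (L ^ 2 * ‖x - y‖ ^ 2)

/-- `F(x) → +∞` as `‖x‖ → ∞`. -/
def Coercive {d : ℕ} (F : Vec d → ℝ) : Prop :=
  Tendsto F (Bornology.cobounded (Vec d)) atTop

/-- The asymptotic regime of the hyperparameters: `(1 - α(γ)) / γ → a` and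
`(1 - β(γ)) / γ → b` as `γ ↓ 0`, where `a, b > 0` and `b ≤ 4 a`. -/
structure Regime (α β : ℝ≥0 → Ico (0 : ℝ) 1) (a b : ℝ) : Prop where
  tendsto_a : Tendsto (fun γ : ℝ≥0 => (1 - (α γ : ℝ)) / (γ : ℝ)) (𝓝[>] 0) (𝓝 a)
  tendsto_b : Tendsto (fun γ : ℝ≥0 => (1 - (β γ : ℝ)) / (γ : ℝ)) (𝓝[>] 0) (𝓝 b)
  a_pos : 0 < a
  b_pos : 0 < b
  b_le : b ≤ 4 * a

/-- The set of critical points of `F`. -/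
def criticalSet {d : ℕ} (F : Vec d → ℝ) : Set (Vec d) :=
  {x | gradient F x = 0}

/-- The vector field of the ODE, at time `t` and at `z = (x, m, v)`. -/
def field {d : ℕ} (F : Vec d → ℝ) (S : Vec d → Vec d) (a b ε : ℝ) (t : ℝ)
    (z : Vec d × Vec d × Vec d) : Vec d × Vec d × Vec d :=
  (WithLp.toLp 2 fun i =>
      -(((1 - Real.exp (-(a * t)))⁻¹ * z.2.1 i) /
        (ε + √((1 - Real.exp (-(b * t)))⁻¹ * z.2.2 i))),
    a • (gradient F z.1 - z.2.1),
    b • (S z.1 - z.2.2))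

/-- `z = (x, m, v)` is a global solution of the ODE with initial condition `(x₀, 0, 0)`.
Only the values `z t` with `t ≥ 0` matter. -/
structure IsGlobalSolution {d : ℕ} (F : Vec d → ℝ) (S : Vec d → Vec d) (a b ε : ℝ)
    (x₀ : Vec d) (z : ℝ → Vec d × Vec d × Vec d) : Prop where
  continuousOn : ContinuousOn z (Ici 0)
  nonneg : ∀ t, 0 ≤ t → ∀ i, 0 ≤ (z t).2.2 i
  contDiffOn : ContDiffOn ℝ 1 z (Ioi 0)
  ode : ∀ t, 0 < t → HasDerivAt z (field F S a b ε t (z t)) t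
  init : z 0 = (x₀, 0, 0)

/-- `θ ∈ (0, 1/2]` is a Łojasiewicz exponent of `F` at `y`. -/
def IsLojasiewiczExponent {d : ℕ} (F : Vec d → ℝ) (y : Vec d) (θ : ℝ) : Prop :=
  θ ∈ Ioc (0 : ℝ) (1 / 2) ∧ ∃ c σ : ℝ, 0 < c ∧ 0 < σ ∧
    ∀ x : Vec d, ‖x - y‖ ≤ σ → c * |F x - F y| ^ (1 - θ) ≤ ‖gradient F x‖

/-- The Łojasiewicz property: each critical point has a Łojasiewicz exponent. -/
def LojasiewiczProperty {d : ℕ} (F : Vec d → ℝ) : Prop :=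
  ∀ y ∈ criticalSet F, ∃ θ : ℝ, IsLojasiewiczExponent F y θ

end

end Adam

/-!
The convergence of the trajectory is proved from a Lyapunov function, a Łojasiewicz inequality
along the trajectory, and the finite length of the latter.

*Regularity of `F`.* The gradient of `f(·, ξ)` is Lipschitz on compact sets only in the `L²` sense,
so that no integrable Lipschitz bound is available for differentiating under the expectation.
Instead, the Taylor remainder of `f(·, ξ)` is written as an integral along a segment and Tonelli's
theorem is applied (`RegularModel.lintegral_taylor_le`). Hence `F` is differentiable with
`∇F = E ∇f(·, ξ)`, and `∇F` is Lipschitz on compact sets, where `S` is bounded.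

*Lyapunov function.* With `Uᵢ = a (1 - e^{-at}) (ε + √(vᵢ / (1 - e^{-bt})))`, the energy
`F(x) + ½ ∑ᵢ mᵢ² / Uᵢ` is dissipated at rate at least `ε (1 - e^{-at}) ‖x'‖²`
(`IsGlobalSolution.exists_hasDerivAt_energy`); the condition `b ≤ 4 a` enters through
`div_debias_le`. By coercivity the trajectory is bounded, whence `S(x)`, `v` and the preconditioner
are bounded and, after time `1`, the energy is dissipated at rate at least `c ‖m‖²`
(`IsGlobalSolution.exists_isDissipative`).

*Dissipation of the gradient.* For small `δ > 0` the modified energy `W = E - δ ⟪∇F(x), m⟫`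
decreases by at least `κ ∫ (‖m‖² + ‖∇F(x)‖²)`. As `∇F` is only Lipschitz, this is obtained from the
upper right Dini derivative of `W` (`IsDissipative.exists_dissipation`). The integral is therefore
finite, `m` and `∇F(x)` tend to `0` along a sequence of times, and a cluster point `y` of `x` along
this sequence is critical with `W → F(y)`. This determines the limit of `W` without any assumption
on the set of critical values.

*Łojasiewicz argument.* Put `ρ² = ‖m‖² + ‖∇F(x)‖² + e^{-2t}` and `R(t) = ∫ₜ^∞ ρ²`. Then
`R' = -ρ²`, `‖x'‖ ≤ k ρ`, and `R` is at most a constant times `|F(x) - F(y)| + ρ²`, so that a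
Łojasiewicz exponent `θ ≤ 1/2` at `y` gives `R ^ (1 - θ) ≤ K ρ` while `x` is near `y`
(`rpow_one_sub_le`). Working with `R` instead of `W` avoids differentiating `W`, and the term
`e^{-2t}` keeps `R` positive, so that its powers are differentiable. Since
`-(R ^ θ)' ≥ (θ / K) ρ`, the length of the curve is controlled by `R ^ θ`: the curve is trapped near
`y` and converges (`tendsto_of_lojasiewicz`), with `‖x - y‖ ≤ const * R ^ θ`
(`norm_sub_limit_le_of_lojasiewicz`). The rates follow from `R' ≤ -K⁻² R ^ (2 - 2 θ)`
(`le_exp_of_lojasiewicz`, `rpow_le_of_lojasiewicz`).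
-/

namespace Adam

/-! ### Regularity of the objective function -/

section Model

variable {d : ℕ} {Ω Ξ : Type*} [MeasurableSpace Ω] [MeasurableSpace Ξ]

theorem lintegral_le_of_lintegral_sq_le {P : Measure Ω} [IsProbabilityMeasure P]
    {h : Ω → ℝ≥0∞} (hh : AEMeasurable h P) {c : ℝ} (hc : 0 ≤ c)
    (H : ∫⁻ ω, h ω ^ 2 ∂P ≤ ENNReal.ofReal (c ^ 2)) : ∫⁻ ω, h ω ∂P ≤ ENNReal.ofReal c := by
  have h1 := ENNReal.lintegral_mul_le_Lp_mul_Lq P Real.HolderConjugate.two_two hh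
    (aemeasurable_const (b := (1 : ℝ≥0∞)))
  simp only [Pi.mul_apply, mul_one, lintegral_const, measure_univ, ENNReal.rpow_two, one_pow,
    ENNReal.one_rpow] at h1
  refine h1.trans ?_
  calc (∫⁻ ω, h ω ^ 2 ∂P) ^ (1 / 2 : ℝ) ≤ (ENNReal.ofReal (c ^ 2)) ^ (1 / 2 : ℝ) :=
        ENNReal.rpow_le_rpow H (by norm_num)
    _ = ENNReal.ofReal c := by
        rw [ENNReal.ofReal_rpow_of_nonneg (by positivity) (by norm_num), ← Real.sqrt_eq_rpow,
          Real.sqrt_sq hc]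

/-- The gradient is a limit of difference quotients, hence measurable in the random variable. -/
theorem measurable_gradx {f : Vec d → Ξ → ℝ} (hf : Measurable (Function.uncurry f))
    (hd : ∀ s, Differentiable ℝ fun x => f x s) (x : Vec d) : Measurable fun s => gradx f x s := by
  have hcoord : Measurable fun s i => gradx f x s i := by
    refine measurable_pi_lambda _ fun i => ?_
    refine measurable_of_tendsto_metrizable
      (f := fun (n : ℕ) s => (n : ℝ) • (f (x + (n : ℝ)⁻¹ • EuclideanSpace.single i 1) s - f x s))
      (fun n => ?_) (tendsto_pi_nhds.2 fun s => ?_)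
    · have h1 : ∀ x, Measurable (f x) := fun x => hf.comp measurable_prodMk_left
      exact ((h1 _).sub (h1 _)).const_mul (n : ℝ)
    · have h1 := (hd s x).hasGradientAt.hasFDerivAt.lim (EuclideanSpace.single i (1 : ℝ))
        (c := fun n : ℕ => (n : ℝ)) (l := atTop)
        (by simpa using tendsto_natCast_atTop_atTop (R := ℝ))
      rw [InnerProductSpace.toDual_apply_apply, EuclideanSpace.inner_single_right] at h1
      simpa [gradx] using h1
  exact (WithLp.measurable_toLp 2 _).comp hcoord

theorem contDiff_one_continuous_gradient {φ : Vec d → ℝ} (hφ : ContDiff ℝ 1 φ) :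
    Continuous (gradient φ) := by
  unfold gradient
  exact (LinearIsometryEquiv.continuous _).comp (hφ.continuous_fderiv one_ne_zero)

/-- The first-order Taylor remainder of a `C¹` function is controlled by the oscillation of the
gradient along the segment. -/
theorem enorm_taylor_le {φ : Vec d → ℝ} (hφ : ContDiff ℝ 1 φ) (x y : Vec d) :
    ‖φ y - φ x - inner ℝ (gradient φ x) (y - x)‖ₑ ≤
      ∫⁻ t in Ioc (0 : ℝ) 1,
        ‖gradient φ (x + t • (y - x)) - gradient φ x‖ₑ * ‖y - x‖ₑ := by
  have hc := contDiff_one_continuous_gradient hφ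
  have hcont : Continuous fun t : ℝ =>
      inner ℝ (gradient φ (x + t • (y - x)) - gradient φ x) (y - x) := by
    have : Continuous fun t : ℝ => gradient φ (x + t • (y - x)) := hc.comp (by fun_prop)
    fun_prop
  have hder : ∀ t : ℝ, HasDerivAt
      (fun t : ℝ => φ (x + t • (y - x)) - t * inner ℝ (gradient φ x) (y - x))
      (inner ℝ (gradient φ (x + t • (y - x)) - gradient φ x) (y - x)) t := by
    intro t
    have h1 : HasDerivAt (fun t : ℝ => x + t • (y - x)) (y - x) t := by
      simpa using ((hasDerivAt_id t).smul_const (y - x)).const_add x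
    have h2 := ((hφ.differentiable one_ne_zero) (x + t • (y - x))).hasGradientAt.hasFDerivAt
    have h3 := (h2.comp_hasDerivAt t h1).sub
      ((hasDerivAt_id t).mul_const (inner ℝ (gradient φ x) (y - x)))
    refine h3.congr_deriv ?_
    simp [inner_sub_left]
  have hint := intervalIntegral.integral_eq_sub_of_hasDerivAt (a := 0) (b := 1)
    (fun t _ => hder t) (hcont.intervalIntegrable 0 1)
  have e1 : φ y - φ x - inner ℝ (gradient φ x) (y - x) =
      ∫ t in Ioc (0 : ℝ) 1, inner ℝ (gradient φ (x + t • (y - x)) - gradient φ x) (y - x) := by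
    rw [← intervalIntegral.integral_of_le zero_le_one, hint]
    simp
    ring
  rw [e1]
  refine (enorm_integral_le_lintegral_enorm _).trans (lintegral_mono fun t => ?_)
  rw [← enorm_norm (gradient φ (x + t • (y - x)) - gradient φ x), ← enorm_norm (y - x),
    ← enorm_mul, ← enorm_norm (inner ℝ _ _)]
  refine enorm_le_iff_norm_le.2 ?_
  simpa using norm_inner_le_norm (𝕜 := ℝ) (gradient φ (x + t • (y - x)) - gradient φ x) (y - x)

variable {P : Measure Ω} {ξ : Ω → Ξ} {f : Vec d → Ξ → ℝ}

theorem RegularModel.measurable_gradx_comp (hf : RegularModel P ξ f) (hξ : Measurable ξ)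
    (x : Vec d) : Measurable fun ω => gradx f x (ξ ω) :=
  (measurable_gradx hf.measurable hf.differentiable x).comp hξ

theorem RegularModel.measurable_comp (hf : RegularModel P ξ f) (hξ : Measurable ξ)
    (x : Vec d) : Measurable fun ω => f x (ξ ω) :=
  (hf.measurable.comp measurable_prodMk_left).comp hξ

theorem RegularModel.lintegral_gradx_sq_le (hf : RegularModel P ξ f) (hξ : Measurable ξ)
    {K : Set (Vec d)} (hK : IsCompact K) : ∃ M : ℝ, ∀ x ∈ K,
      ∫⁻ ω, ‖gradx f x (ξ ω)‖ₑ ^ 2 ∂P ≤ ENNReal.ofReal M := by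
  obtain ⟨y, -, hy⟩ := hf.moments
  obtain ⟨L, hL, hLK⟩ := hf.lipschitz (insert y K) (hK.insert y)
  obtain ⟨D, hD⟩ := hK.exists_bound_of_continuousOn (f := fun x => x - y) (by fun_prop)
  refine ⟨4 * (L ^ 2 * D ^ 2 + (∫⁻ ω, ‖gradx f y (ξ ω)‖ₑ ^ 2 ∂P).toReal), fun x hx => ?_⟩
  have hsq : ∀ A B : ℝ≥0∞, (A + B) ^ 2 ≤ 4 * (A ^ 2 + B ^ 2) := fun A B => by
    calc (A + B) ^ 2 ≤ (2 * max A B) ^ 2 := by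
          rw [two_mul]; gcongr
          exacts [le_max_left _ _, le_max_right _ _]
      _ = 4 * max A B ^ 2 := by rw [mul_pow]; norm_num
      _ ≤ 4 * (A ^ 2 + B ^ 2) := by
          gcongr
          rcases le_total A B with h | h
          · simp [max_eq_right h]
          · simp [max_eq_left h]
  have hm := ((hf.measurable_gradx_comp hξ x).sub (hf.measurable_gradx_comp hξ y)).enorm
  calc ∫⁻ ω, ‖gradx f x (ξ ω)‖ₑ ^ 2 ∂P
      ≤ ∫⁻ ω, 4 * (‖gradx f x (ξ ω) - gradx f y (ξ ω)‖ₑ ^ 2 + ‖gradx f y (ξ ω)‖ₑ ^ 2) ∂P := by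
        refine lintegral_mono fun ω => le_trans ?_ (hsq _ _)
        gcongr
        simpa using enorm_add_le (gradx f x (ξ ω) - gradx f y (ξ ω)) (gradx f y (ξ ω))
    _ = 4 * (∫⁻ ω, ‖gradx f x (ξ ω) - gradx f y (ξ ω)‖ₑ ^ 2 ∂P
          + ∫⁻ ω, ‖gradx f y (ξ ω)‖ₑ ^ 2 ∂P) := by
        rw [lintegral_const_mul' _ _ (by norm_num), lintegral_add_left]
        exact hm.pow_const 2
    _ ≤ 4 * (ENNReal.ofReal (L ^ 2 * D ^ 2)
          + ENNReal.ofReal (∫⁻ ω, ‖gradx f y (ξ ω)‖ₑ ^ 2 ∂P).toReal) := by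
        rw [ENNReal.ofReal_toReal hy.ne]
        gcongr
        refine (hLK x (mem_insert_of_mem _ hx) y (mem_insert _ _)).trans
          (ENNReal.ofReal_le_ofReal ?_)
        gcongr
        exact hD x hx
    _ = _ := by
        rw [← ENNReal.ofReal_add (by positivity) ENNReal.toReal_nonneg,
          ENNReal.ofReal_mul (by norm_num)]
        norm_num

theorem RegularModel.secondMoment_bounded (hf : RegularModel P ξ f) (hξ : Measurable ξ)
    {K : Set (Vec d)} (hK : IsCompact K) : ∃ M : ℝ, ∀ x ∈ K, ∀ i, secondMoment P ξ f x i ≤ M := by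
  obtain ⟨M, hM⟩ := hf.lintegral_gradx_sq_le hξ hK
  refine ⟨max M 0, fun x hx i => (le_abs_self _).trans ?_⟩
  have h1 : ‖∫ ω, (gradx f x (ξ ω) i) ^ 2 ∂P‖ₑ ≤ ENNReal.ofReal (max M 0) := by
    refine (enorm_integral_le_lintegral_enorm _).trans ((lintegral_mono fun ω => ?_).trans
      ((hM x hx).trans (ENNReal.ofReal_le_ofReal (le_max_left _ _))))
    rw [enorm_pow]
    gcongr
    exact enorm_le_iff_norm_le.2 (PiLp.norm_apply_le _ i)
  rw [← ofReal_norm] at h1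
  exact (ENNReal.ofReal_le_ofReal_iff (le_max_right _ _)).1 h1

variable [IsProbabilityMeasure P]

theorem RegularModel.lintegral_gradx_sub_le (hf : RegularModel P ξ f) (hξ : Measurable ξ)
    {K : Set (Vec d)} {L : ℝ} (hL : 0 < L)
    (hK : ∀ x ∈ K, ∀ y ∈ K, ∫⁻ ω, ‖gradx f x (ξ ω) - gradx f y (ξ ω)‖ₑ ^ 2 ∂P ≤
      ENNReal.ofReal (L ^ 2 * ‖x - y‖ ^ 2)) {x y : Vec d} (hx : x ∈ K) (hy : y ∈ K) :
    ∫⁻ ω, ‖gradx f x (ξ ω) - gradx f y (ξ ω)‖ₑ ∂P ≤ ENNReal.ofReal (L * ‖x - y‖) := by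
  refine lintegral_le_of_lintegral_sq_le ?_ (by positivity) ?_
  · exact ((hf.measurable_gradx_comp hξ x).sub (hf.measurable_gradx_comp hξ y)).enorm.aemeasurable
  · rw [mul_pow]; exact hK x hx y hy

/-- The expected Taylor remainder is quadratic. Since the gradient is only Lipschitz in `L²`,
differentiation under the expectation is not available, and the expectation is exchanged with the
integral along the segment instead. -/
theorem RegularModel.lintegral_taylor_le (hf : RegularModel P ξ f) (hξ : Measurable ξ)
    {K : Set (Vec d)} (hconv : Convex ℝ K) {L : ℝ} (hL : 0 < L)
    (hK : ∀ x ∈ K, ∀ y ∈ K, ∫⁻ ω, ‖gradx f x (ξ ω) - gradx f y (ξ ω)‖ₑ ^ 2 ∂P ≤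
      ENNReal.ofReal (L ^ 2 * ‖x - y‖ ^ 2)) {x y : Vec d} (hx : x ∈ K) (hy : y ∈ K) :
    ∫⁻ ω, ‖f y (ξ ω) - f x (ξ ω) - inner ℝ (gradx f x (ξ ω)) (y - x)‖ₑ ∂P ≤
      ENNReal.ofReal (L * ‖y - x‖ ^ 2) := by
  -- Off a measurable null set the gradient is continuous in the space variable, so that setting
  -- it to zero on this set gives a Carathéodory function.
  obtain ⟨N, hN, hNm, hN0⟩ := exists_measurable_superset_of_null (ae_iff.1 hf.contDiff)
  have hNC : ∀ ω ∉ N, ContDiff ℝ 1 fun x => f x (ξ ω) := fun ω hω => by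
    by_contra hc; exact hω (hN hc)
  have hNae : ∀ᵐ ω ∂P, ω ∉ N := by simpa [ae_iff] using hN0
  let u : ℝ → Ω → ℝ≥0∞ := fun t ω =>
    Nᶜ.indicator (fun ω => ‖gradx f (x + t • (y - x)) (ξ ω) - gradx f x (ξ ω)‖ₑ) ω
  have hu : Measurable (Function.uncurry u) := by
    refine measurable_uncurry_of_continuous_of_measurable (fun ω => ?_) (fun t => ?_)
    · by_cases hω : ω ∈ N
      · simpa [u, hω] using continuous_const
      · have := contDiff_one_continuous_gradient (hNC ω hω)
        have h2 : Continuous fun t : ℝ => gradx f (x + t • (y - x)) (ξ ω) :=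
          this.comp (f := fun t : ℝ => x + t • (y - x)) (by fun_prop)
        simp only [u, indicator_of_mem (mem_compl hω)]
        fun_prop
    · exact ((hf.measurable_gradx_comp hξ _).sub
        (hf.measurable_gradx_comp hξ x)).enorm.indicator hNm.compl
  calc ∫⁻ ω, ‖f y (ξ ω) - f x (ξ ω) - inner ℝ (gradx f x (ξ ω)) (y - x)‖ₑ ∂P
      ≤ ∫⁻ ω, (∫⁻ t in Ioc (0 : ℝ) 1, u t ω * ‖y - x‖ₑ) ∂P := by
        refine lintegral_mono_ae ?_
        filter_upwards [hNae] with ω hω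
        simp only [u, indicator_of_mem (mem_compl hω)]
        exact enorm_taylor_le (hNC ω hω) x y
    _ = ∫⁻ t in Ioc (0 : ℝ) 1, ∫⁻ ω, u t ω * ‖y - x‖ₑ ∂P := by
        refine lintegral_lintegral_swap (Measurable.aemeasurable ?_)
        exact (hu.comp measurable_swap).mul_const _
    _ ≤ ∫⁻ _ in Ioc (0 : ℝ) 1, ENNReal.ofReal (L * ‖y - x‖ ^ 2) := by
        refine setLIntegral_mono measurable_const fun t ht => ?_
        rw [lintegral_mul_const _ (show Measurable (u t) from hu.comp measurable_prodMk_left)]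
        have hmem : x + t • (y - x) ∈ K := hconv.add_smul_sub_mem hx hy ⟨ht.1.le, ht.2⟩
        have h1 : ∫⁻ ω, u t ω ∂P ≤ ENNReal.ofReal (L * ‖y - x‖) := by
          refine (lintegral_mono fun ω => indicator_le_self _ _ ω).trans
            ((hf.lintegral_gradx_sub_le hξ hL hK hmem hx).trans (ENNReal.ofReal_le_ofReal ?_))
          rw [add_sub_cancel_left, norm_smul, Real.norm_of_nonneg ht.1.le]
          exact mul_le_mul_of_nonneg_left
            (mul_le_of_le_one_left (norm_nonneg _) ht.2) hL.le
        calc (∫⁻ ω, u t ω ∂P) * ‖y - x‖ₑ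
            ≤ ENNReal.ofReal (L * ‖y - x‖) * ENNReal.ofReal ‖y - x‖ := by
              rw [ofReal_norm]; gcongr
          _ = ENNReal.ofReal (L * ‖y - x‖ ^ 2) := by
              rw [← ENNReal.ofReal_mul (by positivity)]; ring_nf
    _ = ENNReal.ofReal (L * ‖y - x‖ ^ 2) := by simp

theorem RegularModel.integrable_gradx (hf : RegularModel P ξ f) (hξ : Measurable ξ) (x : Vec d) :
    Integrable (fun ω => gradx f x (ξ ω)) P := by
  obtain ⟨M, hM⟩ := hf.lintegral_gradx_sq_le hξ (isCompact_singleton (x := x))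
  refine ⟨(hf.measurable_gradx_comp hξ x).aestronglyMeasurable, ?_⟩
  have := lintegral_le_of_lintegral_sq_le (c := √(max M 0)) 
    (hf.measurable_gradx_comp hξ x).enorm.aemeasurable (Real.sqrt_nonneg _) (by
      rw [Real.sq_sqrt (le_max_right _ _)]
      exact (hM x rfl).trans (ENNReal.ofReal_le_ofReal (le_max_left _ _)))
  exact this.trans_lt ENNReal.ofReal_lt_top

theorem RegularModel.integrable_taylor (hf : RegularModel P ξ f) (hξ : Measurable ξ)
    (x y : Vec d) :
    Integrable (fun ω => f y (ξ ω) - f x (ξ ω) - inner ℝ (gradx f x (ξ ω)) (y - x)) P := by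
  obtain ⟨L, hL, hK⟩ := hf.lipschitz (segment ℝ x y) (by
    rw [segment_eq_image]
    exact isCompact_Icc.image (by fun_prop))
  refine ⟨?_, (hf.lintegral_taylor_le hξ (convex_segment x y) hL hK (left_mem_segment ℝ x y)
    (right_mem_segment ℝ x y)).trans_lt ENNReal.ofReal_lt_top⟩
  exact (((hf.measurable_comp hξ y).sub (hf.measurable_comp hξ x)).sub
    ((hf.measurable_gradx_comp hξ x).inner_const)).aestronglyMeasurable

theorem RegularModel.integrable (hf : RegularModel P ξ f) (hξ : Measurable ξ) (x : Vec d) :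
    Integrable (fun ω => f x (ξ ω)) P := by
  obtain ⟨y, hy, -⟩ := hf.moments
  have h1 : Integrable (fun ω => f y (ξ ω)) P :=
    ⟨(hf.measurable_comp hξ y).aestronglyMeasurable, hy⟩
  have h2 := (hf.integrable_taylor hξ y x).add
    (h1.add ((hf.integrable_gradx hξ y).inner_const (x - y)))
  refine h2.congr (ae_of_all _ fun ω => ?_)
  simp

theorem RegularModel.hasGradientAt_objective (hf : RegularModel P ξ f) (hξ : Measurable ξ)
    (x : Vec d) : HasGradientAt (objective P ξ f) (∫ ω, gradx f x (ξ ω) ∂P) x := by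
  obtain ⟨L, hL, hK⟩ := hf.lipschitz (Metric.closedBall x 1) (isCompact_closedBall x 1)
  rw [hasGradientAt_iff_isLittleO]
  have hO : (fun y => objective P ξ f y - objective P ξ f x -
      inner ℝ (∫ ω, gradx f x (ξ ω) ∂P) (y - x)) =O[𝓝 x] fun y => ‖y - x‖ ^ 2 := by
    refine Asymptotics.IsBigO.of_bound L ?_
    filter_upwards [Metric.closedBall_mem_nhds x one_pos] with y hy
    have e : objective P ξ f y - objective P ξ f x -
        inner ℝ (∫ ω, gradx f x (ξ ω) ∂P) (y - x) =
        ∫ ω, (f y (ξ ω) - f x (ξ ω) - inner ℝ (gradx f x (ξ ω)) (y - x)) ∂P := by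
      have h1 := integral_sub ((hf.integrable hξ y).sub (hf.integrable hξ x))
        ((hf.integrable_gradx hξ x).inner_const (𝕜 := ℝ) (y - x))
      have h2 := integral_sub (hf.integrable hξ y) (hf.integrable hξ x)
      have h3 := integral_inner (𝕜 := ℝ) (hf.integrable_gradx hξ x) (y - x)
      simp_rw [real_inner_comm] at h3 h1 ⊢
      simp only [Pi.sub_apply] at h1
      rw [h1, h2, h3]
      rfl
    rw [e]
    have h1 := (enorm_integral_le_lintegral_enorm _).trans
      (hf.lintegral_taylor_le hξ (convex_closedBall x 1) hL hK
        (Metric.mem_closedBall_self zero_le_one) hy)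
    rw [← ofReal_norm] at h1
    rw [Real.norm_of_nonneg (by positivity : 0 ≤ ‖y - x‖ ^ 2)]
    exact (ENNReal.ofReal_le_ofReal_iff (by positivity)).1 h1
  refine hO.trans_isLittleO ((Asymptotics.isLittleO_norm_pow_id one_lt_two).comp_tendsto
    (k := fun y => y - x) ?_)
  exact tendsto_sub_nhds_zero_iff.2 tendsto_id

theorem RegularModel.gradient_objective (hf : RegularModel P ξ f) (hξ : Measurable ξ)
    (x : Vec d) : gradient (objective P ξ f) x = ∫ ω, gradx f x (ξ ω) ∂P :=
  (hf.hasGradientAt_objective hξ x).gradient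

theorem RegularModel.differentiable_objective (hf : RegularModel P ξ f) (hξ : Measurable ξ) :
    Differentiable ℝ (objective P ξ f) := fun x =>
  (hf.hasGradientAt_objective hξ x).differentiableAt

theorem RegularModel.gradient_lipschitz (hf : RegularModel P ξ f) (hξ : Measurable ξ)
    {K : Set (Vec d)} (hK : IsCompact K) : ∃ L : ℝ, 0 < L ∧ ∀ x ∈ K, ∀ y ∈ K,
      ‖gradient (objective P ξ f) x - gradient (objective P ξ f) y‖ ≤ L * ‖x - y‖ := by
  obtain ⟨L, hL, hLK⟩ := hf.lipschitz K hK
  refine ⟨L, hL, fun x hx y hy => ?_⟩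
  rw [hf.gradient_objective hξ, hf.gradient_objective hξ,
    ← integral_sub (hf.integrable_gradx hξ x) (hf.integrable_gradx hξ y)]
  have h1 := (enorm_integral_le_lintegral_enorm _).trans
    (hf.lintegral_gradx_sub_le hξ hL hLK hx hy)
  rw [← ofReal_norm] at h1
  exact (ENNReal.ofReal_le_ofReal_iff (by positivity)).1 h1

end Model

/-! ### Convergence from a Łojasiewicz inequality -/

section Lojasiewicz

variable {E : Type*} [NormedAddCommGroup E] [NormedSpace ℝ E]

/-- The length of the curve `x` is controlled by the decrease of `R ^ θ`, because
`-(R ^ θ)' = θ * R ^ (θ - 1) * ρ ^ 2 ≥ (θ / K) * ρ`. -/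
theorem norm_sub_le_of_lojasiewicz {x x' : ℝ → E} {R ρ : ℝ → ℝ} {k K θ s t : ℝ}
    (hx : ∀ u ∈ Icc s t, HasDerivAt x (x' u) u) (hx' : ∀ u ∈ Icc s t, ‖x' u‖ ≤ k * ρ u)
    (hR : ∀ u ∈ Icc s t, HasDerivAt R (-ρ u ^ 2) u) (hRpos : ∀ u ∈ Icc s t, 0 < R u)
    (hρ : ∀ u ∈ Icc s t, 0 < ρ u) (hk : 0 ≤ k) (hθ : 0 < θ)
    (hK : ∀ u ∈ Icc s t, R u ^ (1 - θ) ≤ K * ρ u) (hst : s ≤ t) :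
    ‖x t - x s‖ ≤ k * K / θ * (R s ^ θ - R t ^ θ) := by
  have hRd : ∀ u ∈ Icc s t, HasDerivAt (fun u => k * K / θ * (R s ^ θ - R u ^ θ))
      (k * K / θ * (ρ u ^ 2 * θ * R u ^ (θ - 1))) u := fun u hu => by
    refine (((hasDerivAt_const u _).sub ((hR u hu).rpow_const
      (Or.inl (hRpos u hu).ne'))).const_mul _).congr_deriv ?_
    ring
  refine image_norm_le_of_norm_deriv_right_le_deriv_boundary' (f := fun u => x u - x s)
    (B := fun u => k * K / θ * (R s ^ θ - R u ^ θ))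
    (fun u hu => ((hx u hu).sub_const (x s)).continuousAt.continuousWithinAt)
    (fun u hu => ((hx u (Ico_subset_Icc_self hu)).sub_const (x s)).hasDerivWithinAt) (by simp)
    (fun u hu => (hRd u hu).continuousAt.continuousWithinAt)
    (fun u hu => (hRd u (Ico_subset_Icc_self hu)).hasDerivWithinAt) (fun u hu => ?_)
    (right_mem_Icc.2 hst)
  have hu := Ico_subset_Icc_self hu
  have h1 := hRpos u hu
  have h2 := hρ u hu
  have h3 : R u ^ (θ - 1) * R u ^ (1 - θ) = 1 := by
    rw [← Real.rpow_add h1]; simp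
  have h4 : (1 : ℝ) ≤ R u ^ (θ - 1) * (K * ρ u) := by
    refine h3.symm.le.trans ?_
    exact mul_le_mul_of_nonneg_left (hK u hu) (Real.rpow_nonneg h1.le _)
  calc ‖x' u‖ ≤ k * ρ u * 1 := by simpa using hx' u hu
    _ ≤ k * ρ u * (R u ^ (θ - 1) * (K * ρ u)) := by gcongr
    _ = _ := by field_simp

/-- If the Łojasiewicz inequality holds near a cluster point `y` of the curve, then the curve is
trapped near `y`, has finite length, and converges to `y`. -/
theorem tendsto_of_lojasiewicz {x x' : ℝ → E} {R ρ : ℝ → ℝ} {k K θ σ t₀ : ℝ} {y : E}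
    (hx : ∀ u, t₀ ≤ u → HasDerivAt x (x' u) u) (hx' : ∀ u, t₀ ≤ u → ‖x' u‖ ≤ k * ρ u)
    (hR : ∀ u, t₀ ≤ u → HasDerivAt R (-ρ u ^ 2) u) (hRpos : ∀ u, t₀ ≤ u → 0 < R u)
    (hρ : ∀ u, t₀ ≤ u → 0 < ρ u) (hk : 0 ≤ k) (hθ : 0 < θ) (hK0 : 0 ≤ K) (hσ : 0 < σ)
    (hK : ∀ u, t₀ ≤ u → ‖x u - y‖ ≤ σ → R u ^ (1 - θ) ≤ K * ρ u)
    (hR0 : Tendsto R atTop (𝓝 0)) (hy : MapClusterPt y atTop x) :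
    Tendsto x atTop (𝓝 y) := by
  have hlim : Tendsto (fun t => k * K / θ * R t ^ θ) atTop (𝓝 0) := by
    simpa [Real.zero_rpow hθ.ne'] using (hR0.rpow_const (Or.inr hθ.le)).const_mul (k * K / θ)
  rw [Metric.tendsto_atTop]
  intro e he
  set η := min e σ with hη
  have hη0 : 0 < η := lt_min he hσ
  have hfr : ∃ᶠ t in atTop, x t ∈ Metric.ball y (η / 2) :=
    hy.frequently (Metric.ball_mem_nhds y (by positivity))
  obtain ⟨s, hs1, hs2, hs3⟩ := (hfr.and_eventually ((hlim.eventually_lt_const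
    (show (0 : ℝ) < η / 2 by positivity)).and (eventually_ge_atTop t₀))).exists
  rw [mem_ball_iff_norm] at hs1
  refine ⟨s, fun t ht => ?_⟩
  rw [dist_eq_norm]
  refine lt_of_lt_of_le ?_ (min_le_left e σ)
  by_contra hcon
  rw [not_lt, ← hη] at hcon
  -- `τ` is the first exit time from the ball of radius `η`.
  set T := {u | u ∈ Icc s t ∧ η ≤ ‖x u - y‖} with hT
  have hcont : ContinuousOn (fun u => ‖x u - y‖) (Icc s t) := fun u hu =>
    ((hx u (hs3.trans hu.1)).continuousAt.continuousWithinAt.sub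
      continuousWithinAt_const).norm
  have hTc : IsClosed T := isClosed_Icc.isClosed_le continuousOn_const hcont
  have hTb : BddBelow T := ⟨s, fun u hu => hu.1.1⟩
  have hτ := hTc.csInf_mem ⟨t, ⟨⟨ht, le_rfl⟩, hcon⟩⟩ hTb
  set τ := sInf T
  have hbefore : ∀ u ∈ Ico s τ, ‖x u - y‖ ≤ η := fun u hu => by
    by_contra h
    exact absurd (csInf_le hTb ⟨⟨hu.1, hu.2.le.trans hτ.1.2⟩, (not_le.1 h).le⟩) (not_le.2 hu.2)
  have hsτ : s < τ := by
    rcases hτ.1.1.eq_or_lt with h | h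
    · have := hτ.2
      rw [← h] at this
      linarith
    · exact h
  have hin : ∀ u ∈ Icc s τ, ‖x u - y‖ ≤ η := by
    have hcl : closure (Ico s τ) = Icc s τ := closure_Ico hsτ.ne
    intro u hu
    have h1 : ContinuousOn (fun u => ‖x u - y‖) (closure (Ico s τ)) := by
      rw [hcl]; exact hcont.mono (Icc_subset_Icc_right hτ.1.2)
    exact le_on_closure hbefore h1 continuousOn_const (hcl ▸ hu)
  have hlen := norm_sub_le_of_lojasiewicz (s := s) (t := τ) (K := K)
    (fun u hu => hx u (hs3.trans hu.1)) (fun u hu => hx' u (hs3.trans hu.1))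
    (fun u hu => hR u (hs3.trans hu.1)) (fun u hu => hRpos u (hs3.trans hu.1))
    (fun u hu => hρ u (hs3.trans hu.1)) hk hθ
    (fun u hu => hK u (hs3.trans hu.1) ((hin u hu).trans (min_le_right _ _))) hsτ.le
  have hpos : 0 ≤ k * K / θ * R τ ^ θ :=
    mul_nonneg (by positivity) (Real.rpow_nonneg (hRpos τ (hs3.trans hsτ.le)).le _)
  have htri : ‖x τ - y‖ ≤ ‖x τ - x s‖ + ‖x s - y‖ := norm_sub_le_norm_sub_add_norm_sub _ _ _
  have := hτ.2
  rw [mul_sub] at hlen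
  linarith

/-- The distance to the limit is controlled by the remaining energy `R`. -/
theorem norm_sub_limit_le_of_lojasiewicz {x x' : ℝ → E} {R ρ : ℝ → ℝ} {k K θ t₀ : ℝ} {y : E}
    (hx : ∀ u, t₀ ≤ u → HasDerivAt x (x' u) u) (hx' : ∀ u, t₀ ≤ u → ‖x' u‖ ≤ k * ρ u)
    (hR : ∀ u, t₀ ≤ u → HasDerivAt R (-ρ u ^ 2) u) (hRpos : ∀ u, t₀ ≤ u → 0 < R u)
    (hρ : ∀ u, t₀ ≤ u → 0 < ρ u) (hk : 0 ≤ k) (hθ : 0 < θ) (hK0 : 0 ≤ K)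
    (hK : ∀ u, t₀ ≤ u → R u ^ (1 - θ) ≤ K * ρ u)
    (hy : Tendsto x atTop (𝓝 y)) {t : ℝ} (ht : t₀ ≤ t) :
    ‖x t - y‖ ≤ k * K / θ * R t ^ θ := by
  have h1 : Tendsto (fun T => ‖x T - x t‖) atTop (𝓝 ‖y - x t‖) := (hy.sub_const _).norm
  rw [norm_sub_rev]
  refine le_of_tendsto h1 ?_
  filter_upwards [eventually_ge_atTop t] with T hT
  have hlen := norm_sub_le_of_lojasiewicz (s := t) (t := T) (K := K)
    (fun u hu => hx u (ht.trans hu.1)) (fun u hu => hx' u (ht.trans hu.1))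
    (fun u hu => hR u (ht.trans hu.1)) (fun u hu => hRpos u (ht.trans hu.1))
    (fun u hu => hρ u (ht.trans hu.1)) hk hθ (fun u hu => hK u (ht.trans hu.1)) hT
  refine hlen.trans (mul_le_mul_of_nonneg_left ?_ (by positivity))
  have := Real.rpow_nonneg (hRpos T (ht.trans hT)).le θ
  linarith

/-- Decay of the energy for the exponent `1 / 2`: a linear differential inequality. -/
theorem le_exp_of_lojasiewicz {R ρ : ℝ → ℝ} {K t₀ : ℝ}
    (hR : ∀ u, t₀ ≤ u → HasDerivAt R (-ρ u ^ 2) u) (hRpos : ∀ u, t₀ ≤ u → 0 < R u)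
    (hK0 : 0 < K)
    (hK : ∀ u, t₀ ≤ u → R u ^ (1 - 1 / 2 : ℝ) ≤ K * ρ u) {t : ℝ} (ht : t₀ ≤ t) :
    R t ≤ R t₀ * Real.exp (-((t - t₀) / K ^ 2)) := by
  have hd : ∀ u, t₀ ≤ u → HasDerivAt (fun u => R u * Real.exp ((u - t₀) / K ^ 2))
      (-ρ u ^ 2 * Real.exp ((u - t₀) / K ^ 2) +
        R u * (Real.exp ((u - t₀) / K ^ 2) * (1 / K ^ 2))) u := fun u hu =>
    (hR u hu).mul ((((hasDerivAt_id u).sub_const t₀).div_const (K ^ 2)).exp)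
  have hanti : AntitoneOn (fun u => R u * Real.exp ((u - t₀) / K ^ 2)) (Ici t₀) := by
    refine antitoneOn_of_deriv_nonpos (convex_Ici t₀)
      (fun u hu => (hd u hu).continuousAt.continuousWithinAt)
      (fun u hu => (hd u (interior_subset hu)).differentiableAt.differentiableWithinAt)
      (fun u hu => ?_)
    have hu := interior_subset hu
    rw [(hd u hu).deriv]
    have h1 : R u ≤ K ^ 2 * ρ u ^ 2 := by
      have h2 := hK u hu
      have h3 : R u ^ (1 - 1 / 2 : ℝ) = √(R u) := by rw [Real.sqrt_eq_rpow]; norm_num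
      rw [h3] at h2
      calc R u = √(R u) ^ 2 := (Real.sq_sqrt (hRpos u hu).le).symm
        _ ≤ (K * ρ u) ^ 2 := by gcongr
        _ = _ := by ring
    have h4 : R u * (1 / K ^ 2) ≤ ρ u ^ 2 := by
      rw [mul_one_div, div_le_iff₀ (by positivity)]; linarith
    have h5 := Real.exp_pos ((u - t₀) / K ^ 2)
    nlinarith
  have h1 := hanti (self_mem_Ici) ht ht
  simp only [sub_self, zero_div, Real.exp_zero, mul_one] at h1
  rw [Real.exp_neg, ← div_eq_mul_inv, le_div_iff₀ (Real.exp_pos _)]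
  exact h1

/-- Decay of the energy for an exponent `θ < 1 / 2`: the function `R ^ (2 * θ - 1)` grows at least
linearly. -/
theorem rpow_le_of_lojasiewicz {R ρ : ℝ → ℝ} {K t₀ θ : ℝ}
    (hR : ∀ u, t₀ ≤ u → HasDerivAt R (-ρ u ^ 2) u) (hRpos : ∀ u, t₀ ≤ u → 0 < R u)
    (hK0 : 0 < K) (hθ0 : 0 < θ) (hθ : θ < 1 / 2)
    (hK : ∀ u, t₀ ≤ u → R u ^ (1 - θ) ≤ K * ρ u) {t : ℝ} (ht : t₀ < t) :
    R t ^ θ ≤ ((1 - 2 * θ) / K ^ 2 * (t - t₀)) ^ (-(θ / (1 - 2 * θ))) := by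
  have hp : 0 < 1 - 2 * θ := by linarith
  set c := (1 - 2 * θ) / K ^ 2 with hc
  have hc0 : 0 < c := by positivity
  have hd : ∀ u, t₀ ≤ u → HasDerivAt (fun u => R u ^ (2 * θ - 1) - c * (u - t₀))
      (-ρ u ^ 2 * (2 * θ - 1) * R u ^ (2 * θ - 1 - 1) - c * 1) u := fun u hu =>
    ((hR u hu).rpow_const (Or.inl (hRpos u hu).ne')).sub
      (((hasDerivAt_id u).sub_const t₀).const_mul c)
  have hmono : MonotoneOn (fun u => R u ^ (2 * θ - 1) - c * (u - t₀)) (Ici t₀) := by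
    refine monotoneOn_of_deriv_nonneg (convex_Ici t₀)
      (fun u hu => (hd u hu).continuousAt.continuousWithinAt)
      (fun u hu => (hd u (interior_subset hu)).differentiableAt.differentiableWithinAt)
      (fun u hu => ?_)
    have hu := interior_subset hu
    rw [(hd u hu).deriv]
    have hr := hRpos u hu
    have h1 : R u ^ (2 - 2 * θ) ≤ K ^ 2 * ρ u ^ 2 := by
      calc R u ^ (2 - 2 * θ) = (R u ^ (1 - θ)) ^ 2 := by
            rw [← Real.rpow_natCast, ← Real.rpow_mul hr.le]; norm_num; ring_nf
        _ ≤ (K * ρ u) ^ 2 := by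
            have := Real.rpow_nonneg hr.le (1 - θ)
            gcongr; exact hK u hu
        _ = _ := by ring
    have h2 : R u ^ (2 - 2 * θ) * R u ^ (2 * θ - 1 - 1) = 1 := by
      rw [← Real.rpow_add hr]; ring_nf; simp
    have h3 : 1 ≤ K ^ 2 * ρ u ^ 2 * R u ^ (2 * θ - 1 - 1) := by
      refine h2.symm.le.trans ?_
      exact mul_le_mul_of_nonneg_right h1 (Real.rpow_nonneg hr.le _)
    have h4 : c * 1 ≤ c * (K ^ 2 * ρ u ^ 2 * R u ^ (2 * θ - 1 - 1)) := by gcongr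
    have h5 : c * (K ^ 2 * ρ u ^ 2 * R u ^ (2 * θ - 1 - 1)) =
      -ρ u ^ 2 * (2 * θ - 1) * R u ^ (2 * θ - 1 - 1) := by
      rw [hc]; field_simp; ring
    linarith
  have h1 := hmono self_mem_Ici ht.le ht.le
  have h0 := Real.rpow_pos_of_pos (hRpos t₀ le_rfl) (2 * θ - 1)
  simp only [sub_self, mul_zero, sub_zero] at h1
  have hr := hRpos t ht.le
  have h2 : c * (t - t₀) ≤ R t ^ (2 * θ - 1) := by linarith
  have h3 : 0 < c * (t - t₀) := mul_pos hc0 (by linarith)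
  calc R t ^ θ = (R t ^ (2 * θ - 1)) ^ (-(θ / (1 - 2 * θ))) := by
        rw [← Real.rpow_mul hr.le]
        congr 1
        rw [show 2 * θ - 1 = -(1 - 2 * θ) by ring, neg_mul_neg, mul_div_cancel₀ _ hp.ne']
    _ ≤ _ := Real.rpow_le_rpow_of_nonpos h3 h2 (by
        have : 0 < θ / (1 - 2 * θ) := by positivity
        linarith)

end Lojasiewicz

/-! ### The energy of the dynamics -/

noncomputable section

/-- The debiasing factor `1 - e^{-ct}` of an exponential moving average of rate `c`. -/
def debias (c t : ℝ) : ℝ := 1 - Real.exp (-(c * t))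

/-- The coordinate `ε + √(v / (1 - e^{-bt}))` of the preconditioner. -/
def precond (b ε t v : ℝ) : ℝ := ε + √((debias b t)⁻¹ * v)

/-- The energy `F(x) + ½ ∑ᵢ mᵢ² / Uᵢ` with
`Uᵢ = a (1 - e^{-at}) (ε + √(vᵢ / (1 - e^{-bt})))`. -/
def energy {d : ℕ} (F : Vec d → ℝ) (a b ε : ℝ) (z : ℝ → Vec d × Vec d × Vec d) (t : ℝ) : ℝ :=
  F (z t).1 + ∑ i, (z t).2.1 i ^ 2 / (2 * a * (debias a t * precond b ε t ((z t).2.2 i)))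

theorem debias_pos {c t : ℝ} (hc : 0 < c) (ht : 0 < t) : 0 < debias c t := by
  have : Real.exp (-(c * t)) < 1 := by
    rw [← Real.exp_zero]; exact Real.exp_lt_exp.2 (by nlinarith)
  unfold debias; linarith

theorem debias_le_one (c t : ℝ) : debias c t ≤ 1 := by
  have := Real.exp_pos (-(c * t))
  unfold debias; linarith

theorem debias_mono {c s t : ℝ} (hc : 0 < c) (hst : s ≤ t) : debias c s ≤ debias c t := by
  unfold debias; gcongr

theorem hasDerivAt_debias (c t : ℝ) : HasDerivAt (debias c) (c * Real.exp (-(c * t))) t := by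
  refine (((((hasDerivAt_id t).const_mul c).neg).exp).const_sub 1).congr_deriv ?_
  simp; ring

theorem le_precond {b ε t v : ℝ} : ε ≤ precond b ε t v := by
  have := Real.sqrt_nonneg ((debias b t)⁻¹ * v)
  unfold precond; linarith

/-- This is where `b ≤ 4 a` enters: the loss `b / (1 - e^{-bt})` due to the variation of the
preconditioner is absorbed by the damping of the momentum. -/
theorem div_debias_le {a b t : ℝ} (ha : 0 < a) (hb : 0 < b) (hab : b ≤ 4 * a) (ht : 0 < t) :
    b / debias b t ≤ 4 * a + 2 * (a * Real.exp (-(a * t))) / debias a t := by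
  have hB := debias_pos hb ht
  have hA := debias_pos ha ht
  set q := Real.exp (-(a * t)) with hq
  have hq0 : 0 < q := Real.exp_pos _
  have hq1 : q < 1 := by unfold debias at hA; linarith
  have hA' : debias a t = 1 - q := rfl
  have h4 : Real.exp (-(4 * a * t)) = q ^ 4 := by
    rw [hq, ← Real.exp_nat_mul]; congr 1; push_cast; ring
  -- By convexity of the exponential, `c ↦ c / (1 - e^{-ct})` is nondecreasing.
  have hconv : b * (1 - q ^ 4) ≤ 4 * a * debias b t := by
    have h := convexOn_exp.2 (mem_univ (0 : ℝ)) (mem_univ (-(4 * a * t)))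
      (sub_nonneg.2 ((div_le_one (by positivity : 0 < 4 * a)).2 hab))
      (div_nonneg hb.le (by positivity : 0 ≤ 4 * a)) (sub_add_cancel 1 (b / (4 * a)))
    have e1 : (1 - b / (4 * a)) • (0 : ℝ) + (b / (4 * a)) • (-(4 * a * t)) = -(b * t) := by
      simp only [smul_eq_mul]; field_simp; ring
    rw [e1, h4, Real.exp_zero] at h
    simp only [smul_eq_mul, mul_one] at h
    have h5 : b / (4 * a) * (1 - q ^ 4) ≤ debias b t := by unfold debias; linarith
    rw [div_mul_eq_mul_div, div_le_iff₀ (by positivity)] at h5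
    linarith
  rw [hA', div_le_iff₀ hB]
  have h1q : 0 < 1 - q := by linarith
  have hq4 : 0 < 1 - q ^ 4 := by
    have : q ^ 4 < 1 := pow_lt_one₀ hq0.le hq1 (by norm_num)
    linarith
  have hk : 4 * a ≤ (4 * a + 2 * (a * q) / (1 - q)) * (1 - q ^ 4) := by
    have : (4 * a + 2 * (a * q) / (1 - q)) * (1 - q ^ 4) - 4 * a =
        2 * a * q * (1 + q + q ^ 2 - q ^ 3) := by
      field_simp; ring
    have h3 : q ^ 3 ≤ 1 := pow_le_one₀ hq0.le hq1.le
    have : 0 ≤ 2 * a * q * (1 + q + q ^ 2 - q ^ 3) :=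
      mul_nonneg (by positivity) (by nlinarith)
    linarith
  have h6 : b * (1 - q ^ 4) ≤
      ((4 * a + 2 * (a * q) / (1 - q)) * debias b t) * (1 - q ^ 4) := by
    nlinarith [mul_le_mul_of_nonneg_right hk hB.le]
  exact le_of_mul_le_mul_right h6 hq4

/-- The preconditioner cannot decrease too fast, since `S ≥ 0`. -/
theorem exists_hasDerivAt_precond {b ε t s : ℝ} {v : ℝ → ℝ} (hb : 0 < b) (ht : 0 < t)
    (hs : 0 ≤ s) (hv : 0 < v t) (hv' : HasDerivAt v (b * (s - v t)) t) :
    ∃ D', HasDerivAt (fun t => precond b ε t (v t)) D' t ∧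
      -(b / debias b t * (precond b ε t (v t) - ε) / 2) ≤ D' := by
  have hB := debias_pos hb ht
  have hw : 0 < (debias b t)⁻¹ * v t := by positivity
  have dw := ((hasDerivAt_debias b t).inv hB.ne').mul hv'
  refine ⟨_, (dw.sqrt hw.ne').const_add ε, ?_⟩
  have hBdef : Real.exp (-(b * t)) = 1 - debias b t := by unfold debias; ring
  simp only [precond, Pi.mul_apply, Pi.inv_apply, add_sub_cancel_left]
  rw [hBdef]
  set B := debias b t
  have hσ : 0 < √(B⁻¹ * v t) := Real.sqrt_pos.2 hw
  have hσ2 : √(B⁻¹ * v t) ^ 2 = B⁻¹ * v t := Real.sq_sqrt hw.le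
  set σ := √(B⁻¹ * v t)
  rw [le_div_iff₀ (by positivity)]
  have e1 : -(b / B * σ / 2) * (2 * σ) = -(b / B * σ ^ 2) := by ring
  have e2 : -(b * (1 - B)) / B ^ 2 * v t + B⁻¹ * (b * (s - v t)) =
      -(b / B * (B⁻¹ * v t)) + b * s / B := by field_simp; ring
  rw [e1, hσ2, e2]
  have : 0 ≤ b * s / B := by positivity
  linarith

/-- One coordinate of the energy estimate. -/
theorem exists_hasDerivAt_kinetic {a b ε t g s : ℝ} {m v : ℝ → ℝ} (ha : 0 < a) (hb : 0 < b)
    (hab : b ≤ 4 * a) (hε : 0 < ε) (ht : 0 < t) (hs : 0 ≤ s) (hv : 0 < v t)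
    (hm' : HasDerivAt m (a * (g - m t)) t) (hv' : HasDerivAt v (b * (s - v t)) t) :
    ∃ e', HasDerivAt (fun t => m t ^ 2 / (2 * a * (debias a t * precond b ε t (v t)))) e' t ∧
      e' ≤ g * (m t / (debias a t * precond b ε t (v t)))
        - ε * debias a t * (m t / (debias a t * precond b ε t (v t))) ^ 2 := by
  have hA := debias_pos ha ht
  have hD : ε ≤ precond b ε t (v t) := le_precond
  obtain ⟨D', dD, hD'⟩ := exists_hasDerivAt_precond (ε := ε) hb ht hs hv hv'
  have dA := hasDerivAt_debias a t
  have hkey := div_debias_le ha hb hab ht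
  have hA' : 0 ≤ a * Real.exp (-(a * t)) := by positivity
  have dE := (hm'.fun_pow 2).fun_div ((dA.fun_mul dD).const_mul (2 * a))
    (by have : 0 < 2 * a * (debias a t * precond b ε t (v t)) := by
          have := hε.trans_le hD
          positivity
        exact this.ne')
  refine ⟨_, dE, ?_⟩
  set A := debias a t
  set D := precond b ε t (v t)
  set A' := a * Real.exp (-(a * t))
  set β := b / debias b t
  have hD0 : 0 < D := hε.trans_le hD
  have h1 : 0 ≤ 2 * a * A * (D - ε) + A' * D + A * D' := by
    have h2 : A * β ≤ 4 * a * A + 2 * A' := by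
      calc A * β ≤ A * (4 * a + 2 * A' / A) := by gcongr
        _ = _ := by field_simp
    have h3 : A * -(β * (D - ε) / 2) ≤ A * D' := by gcongr
    have h4 : A' * (D - ε) ≤ A' * D := by
      apply mul_le_mul_of_nonneg_left _ hA'; linarith
    have h5 : A * β * (D - ε) ≤ (4 * a * A + 2 * A') * (D - ε) :=
      mul_le_mul_of_nonneg_right h2 (by linarith)
    nlinarith
  have e1 : g * (m t / (A * D)) - ε * A * (m t / (A * D)) ^ 2 -
      ((2 : ℕ) * m t ^ (2 - 1) * (a * (g - m t)) * (2 * a * (A * D)) -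
        m t ^ 2 * (2 * a * (A' * D + A * D'))) / (2 * a * (A * D)) ^ 2 =
      m t ^ 2 / (2 * a * (A * D) ^ 2) * (2 * a * A * (D - ε) + A' * D + A * D') := by
    field_simp
    push_cast
    ring
  have : 0 ≤ m t ^ 2 / (2 * a * (A * D) ^ 2) * (2 * a * A * (D - ε) + A' * D + A * D') :=
    mul_nonneg (by positivity) h1
  linarith

section Solution

variable {d : ℕ} {F : Vec d → ℝ} {S : Vec d → Vec d} {a b ε : ℝ} {x₀ : Vec d}
  {z : ℝ → Vec d × Vec d × Vec d}

theorem hasDerivAt_coord {y : ℝ → Vec d} {y' : Vec d} {t : ℝ}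
    (h : HasDerivAt y y' t) (i : Fin d) : HasDerivAt (fun t => y t i) (y' i) t :=
  (EuclideanSpace.proj (𝕜 := ℝ) i).hasFDerivAt.comp_hasDerivAt t h

namespace IsGlobalSolution

theorem hasDerivAt_x (hz : IsGlobalSolution F S a b ε x₀ z) {t : ℝ} (ht : 0 < t) :
    HasDerivAt (fun t => (z t).1) (field F S a b ε t (z t)).1 t :=
  (hz.ode t ht).fst

theorem hasDerivAt_m (hz : IsGlobalSolution F S a b ε x₀ z) {t : ℝ} (ht : 0 < t) :
    HasDerivAt (fun t => (z t).2.1) (a • (gradient F (z t).1 - (z t).2.1)) t :=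
  (hz.ode t ht).snd.fst

theorem hasDerivAt_v (hz : IsGlobalSolution F S a b ε x₀ z) {t : ℝ} (ht : 0 < t) (i : Fin d) :
    HasDerivAt (fun t => (z t).2.2 i) (b * (S (z t).1 i - (z t).2.2 i)) t := by
  have h : HasDerivAt (fun t => (z t).2.2) (b • (S (z t).1 - (z t).2.2)) t :=
    (hz.ode t ht).snd.snd
  exact hasDerivAt_coord h i

theorem field_apply {t : ℝ} (w : Vec d × Vec d × Vec d) (i : Fin d) :
    (field F S a b ε t w).1 i = -(w.2.1 i / (debias a t * precond b ε t (w.2.2 i))) := by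
  simp only [field, precond, debias]
  rw [inv_mul_eq_div, div_div]

theorem continuousOn_v (hz : IsGlobalSolution F S a b ε x₀ z) (i : Fin d) :
    ContinuousOn (fun t => (z t).2.2 i) (Ici 0) :=
  (EuclideanSpace.proj (𝕜 := ℝ) i).continuous.comp_continuousOn hz.continuousOn.snd.snd

theorem hasDerivAt_exp_mul_v (hz : IsGlobalSolution F S a b ε x₀ z) {t : ℝ} (ht : 0 < t)
    (i : Fin d) (M : ℝ) : HasDerivAt (fun t => Real.exp (b * t) * ((z t).2.2 i - M))
      (b * Real.exp (b * t) * (S (z t).1 i - M)) t := by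
  refine ((((hasDerivAt_id t).const_mul b).exp).fun_mul
    ((hz.hasDerivAt_v ht i).sub_const M)).congr_deriv ?_
  simp; ring

theorem v_pos (hz : IsGlobalSolution F S a b ε x₀ z) (hb : 0 < b) (hS : ∀ x i, 0 < S x i)
    {t : ℝ} (ht : 0 < t) (i : Fin d) : 0 < (z t).2.2 i := by
  have hmono : StrictMonoOn (fun t => Real.exp (b * t) * ((z t).2.2 i - 0)) (Ici 0) := by
    refine strictMonoOn_of_deriv_pos (convex_Ici 0) ?_ fun u hu => ?_
    · have := hz.continuousOn_v i
      fun_prop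
    · rw [interior_Ici] at hu
      rw [(hz.hasDerivAt_exp_mul_v hu i 0).deriv]
      have := hS (z u).1 i
      rw [sub_zero]
      positivity
  have h := hmono self_mem_Ici ht.le ht
  simp only [hz.init] at h
  have h2 : 0 < Real.exp (b * t) * (z t).2.2 i := by simpa using h
  exact pos_of_mul_pos_right h2 (Real.exp_pos _).le

theorem v_le (hz : IsGlobalSolution F S a b ε x₀ z) (hb : 0 < b) {M t₀ : ℝ} (ht₀ : 0 < t₀)
    {i : Fin d} (hM : ∀ t, t₀ ≤ t → S (z t).1 i ≤ M) (h0 : (z t₀).2.2 i ≤ M) {t : ℝ}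
    (ht : t₀ ≤ t) : (z t).2.2 i ≤ M := by
  have hd : ∀ u ∈ Ici t₀, HasDerivAt (fun t => Real.exp (b * t) * ((z t).2.2 i - M))
      (b * Real.exp (b * u) * (S (z u).1 i - M)) u := fun u hu =>
    hz.hasDerivAt_exp_mul_v (ht₀.trans_le hu) i M
  have hanti : AntitoneOn (fun t => Real.exp (b * t) * ((z t).2.2 i - M)) (Ici t₀) := by
    refine antitoneOn_of_deriv_nonpos (convex_Ici t₀)
      (fun u hu => (hd u hu).continuousAt.continuousWithinAt)
      (fun u hu => (hd u (interior_subset hu)).differentiableAt.differentiableWithinAt)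
      (fun u hu => ?_)
    have hu := interior_subset hu
    rw [(hd u hu).deriv]
    exact mul_nonpos_of_nonneg_of_nonpos (by positivity) (sub_nonpos.2 (hM u hu))
  have h := hanti self_mem_Ici ht ht
  have h1 : Real.exp (b * t₀) * ((z t₀).2.2 i - M) ≤ 0 :=
    mul_nonpos_of_nonneg_of_nonpos (by positivity) (sub_nonpos.2 h0)
  have h2 := h.trans h1
  have := nonpos_of_mul_nonpos_right h2 (Real.exp_pos _)
  linarith

/-- The energy is dissipated at a rate at least proportional to `‖x'‖²`. -/
theorem exists_hasDerivAt_energy (hz : IsGlobalSolution F S a b ε x₀ z)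
    (hF : Differentiable ℝ F) (ha : 0 < a) (hb : 0 < b) (hab : b ≤ 4 * a) (hε : 0 < ε)
    (hS : ∀ x i, 0 < S x i) {t : ℝ} (ht : 0 < t) :
    ∃ e', HasDerivAt (energy F a b ε z) e' t ∧
      e' ≤ -(ε * debias a t * ‖(field F S a b ε t (z t)).1‖ ^ 2) := by
  have h1 := fun i => exists_hasDerivAt_kinetic ha hb hab hε ht (hS (z t).1 i).le
    (hz.v_pos hb hS ht i) (hasDerivAt_coord (hz.hasDerivAt_m ht) i) (hz.hasDerivAt_v ht i)
  choose e' he' hle using h1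
  have h2 := (hF (z t).1).hasGradientAt.hasFDerivAt.comp_hasDerivAt t (hz.hasDerivAt_x ht)
  refine ⟨_, h2.add (HasDerivAt.fun_sum fun i _ => he' i), ?_⟩
  rw [InnerProductSpace.toDual_apply_apply, PiLp.inner_apply, ← Finset.sum_add_distrib,
    EuclideanSpace.norm_sq_eq, Finset.mul_sum, ← Finset.sum_neg_distrib]
  refine Finset.sum_le_sum fun i _ => ?_
  have h3 : e' i ≤ gradient F (z t).1 i * ((z t).2.1 i / (debias a t * precond b ε t ((z t).2.2 i)))
    - ε * debias a t * ((z t).2.1 i / (debias a t * precond b ε t ((z t).2.2 i))) ^ 2 := hle i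
  rw [field_apply, norm_neg, Real.norm_eq_abs, sq_abs]
  simp only [RCLike.inner_apply, conj_trivial]
  linarith

end IsGlobalSolution

end Solution

end

/-! ### Dissipative momentum dynamics -/

section Dissipative

variable {V : Type*} [NormedAddCommGroup V] [InnerProductSpace ℝ V] [CompleteSpace V]

/-- A curve `x` in a compact set `K`, driven on `[1, ∞)` by a momentum `m` that averages the
gradient of `F` at rate `a`, with an energy `e` comparable to `F(x) + ‖m‖²` and dissipated at
rate at least `c ‖m‖²`. The gradient of `F` is `L`-Lipschitz on `K`. -/
structure IsDissipative (F : V → ℝ) (x x' m : ℝ → V) (e e' : ℝ → ℝ) (K : Set V)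
    (a k c c₁ C L : ℝ) : Prop where
  a_pos : 0 < a
  k_nonneg : 0 ≤ k
  c_pos : 0 < c
  c₁_pos : 0 < c₁
  C_nonneg : 0 ≤ C
  L_nonneg : 0 ≤ L
  compact : IsCompact K
  continuous : Continuous F
  continuous_gradient : Continuous (gradient F)
  lipschitz : ∀ y ∈ K, ∀ y' ∈ K, ‖gradient F y - gradient F y'‖ ≤ L * ‖y - y'‖
  mem : ∀ t, 1 ≤ t → x t ∈ K
  deriv_x : ∀ t, 1 ≤ t → HasDerivAt x (x' t) t
  norm_deriv_x : ∀ t, 1 ≤ t → ‖x' t‖ ≤ k * ‖m t‖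
  deriv_m : ∀ t, 1 ≤ t → HasDerivAt m (a • (gradient F (x t) - m t)) t
  deriv_e : ∀ t, 1 ≤ t → HasDerivAt e (e' t) t
  deriv_e_le : ∀ t, 1 ≤ t → e' t ≤ -(c * ‖m t‖ ^ 2)
  le_e : ∀ t, 1 ≤ t → F (x t) + c₁ * ‖m t‖ ^ 2 ≤ e t
  e_le : ∀ t, 1 ≤ t → e t ≤ F (x t) + C * ‖m t‖ ^ 2

namespace IsDissipative

variable {F : V → ℝ} {x x' m : ℝ → V} {e e' : ℝ → ℝ} {K : Set V} {a k c c₁ C L : ℝ}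

theorem continuousOn_x (h : IsDissipative F x x' m e e' K a k c c₁ C L) :
    ContinuousOn x (Ici 1) :=
  fun t ht => (h.deriv_x t ht).continuousAt.continuousWithinAt

theorem continuousOn_m (h : IsDissipative F x x' m e e' K a k c c₁ C L) :
    ContinuousOn m (Ici 1) :=
  fun t ht => (h.deriv_m t ht).continuousAt.continuousWithinAt

theorem continuousOn_e (h : IsDissipative F x x' m e e' K a k c c₁ C L) :
    ContinuousOn e (Ici 1) :=
  fun t ht => (h.deriv_e t ht).continuousAt.continuousWithinAt

/-- The function `t ↦ ‖m‖² + ‖∇F(x)‖²` on `[1, ∞)` has a primitive. -/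
theorem exists_primitive (h : IsDissipative F x x' m e e' K a k c c₁ C L) :
    ∃ Q : ℝ → ℝ, ∀ t, 1 ≤ t → HasDerivAt Q (‖m t‖ ^ 2 + ‖gradient F (x t)‖ ^ 2) t := by
  have hmax : ∀ t : ℝ, max 1 t ∈ Ici (1 : ℝ) := fun t => le_max_left 1 t
  have hc1 : Continuous fun t => m (max 1 t) :=
    h.continuousOn_m.comp_continuous (by fun_prop) hmax
  have hc2 : Continuous fun t => x (max 1 t) :=
    h.continuousOn_x.comp_continuous (by fun_prop) hmax
  have hc3 : Continuous fun t => gradient F (x (max 1 t)) := h.continuous_gradient.comp hc2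
  have hc : Continuous fun t => ‖m (max 1 t)‖ ^ 2 + ‖gradient F (x (max 1 t))‖ ^ 2 :=
    (hc1.norm.pow 2).add (hc3.norm.pow 2)
  refine ⟨fun t => ∫ u in (1 : ℝ)..t, (‖m (max 1 u)‖ ^ 2 + ‖gradient F (x (max 1 u))‖ ^ 2),
    fun t ht => ?_⟩
  have := (hc.integral_hasStrictDerivAt 1 t).hasDerivAt
  rwa [max_eq_right ht] at this

/-- Subtracting a small multiple of `⟪∇F(x), m⟫` from the energy makes the dissipation control
`‖∇F(x)‖²` as well. As `∇F` is only Lipschitz, the modified energy need not be differentiable, and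
the estimate bounds its upper right Dini derivative. -/
theorem exists_dissipation (h : IsDissipative F x x' m e e' K a k c c₁ C L) {Q : ℝ → ℝ}
    (hQ : ∀ t, 1 ≤ t → HasDerivAt Q (‖m t‖ ^ 2 + ‖gradient F (x t)‖ ^ 2) t) :
    ∃ δ κ : ℝ, 0 < δ ∧ δ ≤ c₁ ∧ 0 < κ ∧ ∀ s t, 1 ≤ s → s ≤ t →
      e t - δ * inner ℝ (gradient F (x t)) (m t) + κ * (Q t - Q s) ≤
        e s - δ * inner ℝ (gradient F (x s)) (m s) := by
  have ha := h.a_pos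
  have hk := h.k_nonneg
  have hL := h.L_nonneg
  have hc := h.c_pos
  have hc₁ := h.c₁_pos
  obtain ⟨δ, hδ, hδ1, hδ2⟩ : ∃ δ : ℝ, 0 < δ ∧ δ ≤ c₁ ∧ δ * (L * k + a / 2) ≤ c / 2 := by
    refine ⟨min c₁ (c / 2 / (L * k + a / 2)), by positivity, min_le_left _ _, ?_⟩
    calc min c₁ (c / 2 / (L * k + a / 2)) * (L * k + a / 2)
        ≤ c / 2 / (L * k + a / 2) * (L * k + a / 2) := by gcongr; exact min_le_right _ _
      _ = c / 2 := by field_simp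
  obtain ⟨κ, hκ, hκ1, hκ2⟩ : ∃ κ : ℝ, 0 < κ ∧ κ ≤ c / 2 ∧ κ ≤ δ * a / 2 :=
    ⟨min (c / 2) (δ * a / 2), by positivity, min_le_left _ _, min_le_right _ _⟩
  refine ⟨δ, κ, hδ, hδ1, hκ, fun s t hs hst => ?_⟩
  have hGc : ContinuousOn (fun u => gradient F (x u)) (Ici 1) :=
    h.continuous_gradient.comp_continuousOn h.continuousOn_x
  have hsub : Icc s t ⊆ Ici 1 := fun u hu => hs.trans hu.1
  have key := image_le_of_liminf_slope_right_le_deriv_boundary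
    (f := fun u => e u - δ * inner ℝ (gradient F (x u)) (m u)) (a := s) (b := t)
    (B := fun u => e s - δ * inner ℝ (gradient F (x s)) (m s) - κ * (Q u - Q s))
    (B' := fun u => -(κ * (‖m u‖ ^ 2 + ‖gradient F (x u)‖ ^ 2)))
    (ContinuousOn.mono (h.continuousOn_e.sub
      (continuousOn_const.mul (hGc.inner h.continuousOn_m))) hsub) (by simp)
    (fun u hu => by
      have := (hQ u (hsub hu)).continuousAt.continuousWithinAt (s := Icc s t)
      fun_prop)
    (fun u hu => by
      have := (((hQ u (hs.trans hu.1)).sub_const (Q s)).const_mul κ).const_sub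
        (e s - δ * inner ℝ (gradient F (x s)) (m s))
      exact this.hasDerivWithinAt)
    (fun u hu r hr => ?_) (right_mem_Icc.2 hst)
  · linarith
  refine Eventually.frequently ?_
  have hu1 : 1 ≤ u := hs.trans hu.1
  have hle : 𝓝[>] u ≤ 𝓝[≠] u := nhdsWithin_mono _ fun y hy => ne_of_gt hy
  -- The derivative of `m` and the Lipschitz bound on `∇F` give a bound on the difference
  -- quotients of the modified energy whose limit is at most `-κ (‖m‖² + ‖∇F(x)‖²)`.
  have hlim : Tendsto (fun w => slope e u w + δ * (L * ‖slope x u w‖ * ‖m w‖)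
      - δ * inner ℝ (gradient F (x u)) (slope m u w)) (𝓝[>] u)
      (𝓝 (e' u + δ * (L * ‖x' u‖ * ‖m u‖)
        - δ * inner ℝ (gradient F (x u)) (a • (gradient F (x u) - m u)))) := by
    have h1 := (hasDerivAt_iff_tendsto_slope.1 (h.deriv_e u hu1)).mono_left hle
    have h2 := (hasDerivAt_iff_tendsto_slope.1 (h.deriv_x u hu1)).mono_left hle
    have h3 := (hasDerivAt_iff_tendsto_slope.1 (h.deriv_m u hu1)).mono_left hle
    have h4 : Tendsto m (𝓝[>] u) (𝓝 (m u)) :=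
      (h.deriv_m u hu1).continuousAt.tendsto.mono_left nhdsWithin_le_nhds
    exact (h1.add (((h2.norm.const_mul L).mul h4.norm).const_mul δ)).sub
      ((tendsto_const_nhds.inner h3).const_mul δ)
  have hval : e' u + δ * (L * ‖x' u‖ * ‖m u‖)
      - δ * inner ℝ (gradient F (x u)) (a • (gradient F (x u) - m u)) < r := by
    refine lt_of_le_of_lt ?_ hr
    have h1 := h.deriv_e_le u hu1
    have h2 : δ * (L * ‖x' u‖ * ‖m u‖) ≤ δ * (L * (k * ‖m u‖) * ‖m u‖) := by
      gcongr; exact h.norm_deriv_x u hu1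
    have h3 := real_inner_le_norm (gradient F (x u)) (m u)
    rw [inner_smul_right, inner_sub_right, real_inner_self_eq_norm_sq]
    set g := ‖gradient F (x u)‖
    set μ := ‖m u‖
    have h4 : δ * a * inner ℝ (gradient F (x u)) (m u) ≤ δ * a * (g * μ) := by gcongr
    have h5 : δ * a * (g * μ) ≤ δ * a * ((g ^ 2 + μ ^ 2) / 2) := by
      gcongr; nlinarith [sq_nonneg (g - μ)]
    have h6 : δ * (L * k + a / 2) * μ ^ 2 ≤ c / 2 * μ ^ 2 := by gcongr
    have h7 : κ * μ ^ 2 ≤ c / 2 * μ ^ 2 := by gcongr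
    have h8 : κ * g ^ 2 ≤ δ * a / 2 * g ^ 2 := by gcongr
    linarith
  filter_upwards [hlim.eventually_lt_const hval, self_mem_nhdsWithin] with w hw huw
  refine lt_of_le_of_lt ?_ hw
  have hwu : 0 < w - u := sub_pos.2 huw
  have hw1 : 1 ≤ w := hu1.trans (le_of_lt huw)
  have hlip : -((w - u)⁻¹ * inner ℝ (gradient F (x w) - gradient F (x u)) (m w)) ≤
      L * ‖slope x u w‖ * ‖m w‖ := by
    have h1 := h.lipschitz _ (h.mem w hw1) _ (h.mem u hu1)
    have h2 := neg_le_of_abs_le (abs_real_inner_le_norm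
      (gradient F (x w) - gradient F (x u)) (m w))
    rw [slope_def_module, norm_smul, norm_inv, Real.norm_of_nonneg hwu.le]
    calc -((w - u)⁻¹ * inner ℝ (gradient F (x w) - gradient F (x u)) (m w))
        = (w - u)⁻¹ * -inner ℝ (gradient F (x w) - gradient F (x u)) (m w) := by ring
      _ ≤ (w - u)⁻¹ * (L * ‖x w - x u‖ * ‖m w‖) := by
          gcongr
          exact (neg_le.1 h2).trans (by gcongr)
      _ = _ := by ring
  have hid : slope (fun u => e u - δ * inner ℝ (gradient F (x u)) (m u)) u w =
      slope e u w + δ * -((w - u)⁻¹ * inner ℝ (gradient F (x w) - gradient F (x u)) (m w))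
        - δ * inner ℝ (gradient F (x u)) (slope m u w) := by
    rw [slope_def_module, slope_def_module, slope_def_module, inner_smul_right, inner_sub_right,
      inner_sub_left]
    simp only [smul_eq_mul]
    ring
  rw [hid]
  gcongr

theorem antitoneOn_e (h : IsDissipative F x x' m e e' K a k c c₁ C L) :
    AntitoneOn e (Ici 1) := by
  refine antitoneOn_of_deriv_nonpos (convex_Ici 1) h.continuousOn_e
    (fun u hu => (h.deriv_e u (interior_subset hu)).differentiableAt.differentiableWithinAt)
    (fun u hu => ?_)
  have hu : 1 ≤ u := interior_subset hu
  rw [(h.deriv_e u hu).deriv]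
  have := h.deriv_e_le u hu
  have := h.c_pos
  have : 0 ≤ c * ‖m u‖ ^ 2 := by positivity
  linarith

theorem exists_norm_bound (h : IsDissipative F x x' m e e' K a k c c₁ C L) :
    ∃ M : ℝ, ∀ t, 1 ≤ t → ‖m t‖ ^ 2 + ‖gradient F (x t)‖ ^ 2 ≤ M := by
  obtain ⟨M₁, hM₁⟩ := h.compact.exists_bound_of_continuousOn h.continuous.continuousOn
  obtain ⟨M₂, hM₂⟩ := h.compact.exists_bound_of_continuousOn h.continuous_gradient.continuousOn
  refine ⟨(e 1 + M₁) / c₁ + M₂ ^ 2, fun t ht => add_le_add ?_ ?_⟩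
  · rw [le_div_iff₀ h.c₁_pos]
    have h1 := h.le_e t ht
    have h2 := h.antitoneOn_e self_mem_Ici ht ht
    have h3 := neg_le_of_abs_le (hM₁ _ (h.mem t ht))
    linarith
  · have := hM₂ _ (h.mem t ht)
    gcongr

/-- The modified energy is comparable to `F(x)`. -/
theorem abs_modified_energy_sub_le (h : IsDissipative F x x' m e e' K a k c c₁ C L) {δ : ℝ}
    (hδ : 0 ≤ δ) {t : ℝ} (ht : 1 ≤ t) :
    |e t - δ * inner ℝ (gradient F (x t)) (m t) - F (x t)| ≤
      (C + δ) * (‖m t‖ ^ 2 + ‖gradient F (x t)‖ ^ 2) := by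
  have h1 := h.le_e t ht
  have h2 := h.e_le t ht
  have hc₁ := h.c₁_pos
  have hC := h.C_nonneg
  have h3 : 0 ≤ c₁ * ‖m t‖ ^ 2 := by positivity
  have h4 : |δ * inner ℝ (gradient F (x t)) (m t)| ≤
      δ * (‖m t‖ ^ 2 + ‖gradient F (x t)‖ ^ 2) := by
    rw [abs_mul, abs_of_nonneg hδ]
    gcongr
    refine (abs_real_inner_le_norm _ _).trans ?_
    nlinarith [sq_nonneg (‖gradient F (x t)‖ - ‖m t‖), sq_nonneg ‖gradient F (x t)‖,
      sq_nonneg ‖m t‖]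
  have h5 : 0 ≤ C * ‖gradient F (x t)‖ ^ 2 := by positivity
  have h6 := abs_le.1 h4
  rw [abs_le]
  constructor <;> nlinarith

/-- The remaining dissipation `R t = ∫ₜ^∞ (‖m‖² + ‖∇F(x)‖² + e^{-2s}) ds` is finite and controlled
by the excess of the modified energy; along some sequence of times the gradient and the momentum
vanish, so that `x` has a critical cluster point `y`. The term `e^{-2s}` keeps `R` positive. -/
theorem exists_remaining_dissipation (h : IsDissipative F x x' m e e' K a k c c₁ C L) :
    ∃ (R : ℝ → ℝ) (y : V) (B : ℝ), 0 < B ∧ gradient F y = 0 ∧ MapClusterPt y atTop x ∧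
      Tendsto R atTop (𝓝 0) ∧
      (∀ t, 1 ≤ t → HasDerivAt R
        (-(‖m t‖ ^ 2 + ‖gradient F (x t)‖ ^ 2 + Real.exp (-(2 * t)))) t) ∧
      (∀ t, 1 ≤ t → 0 < R t) ∧
      ∀ t, 1 ≤ t → R t ≤ B * (|F (x t) - F y| +
        (‖m t‖ ^ 2 + ‖gradient F (x t)‖ ^ 2 + Real.exp (-(2 * t)))) := by
  obtain ⟨Q, hQ⟩ := h.exists_primitive
  obtain ⟨δ, κ, hδ, hδ1, hκ, hW⟩ := h.exists_dissipation hQ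
  obtain ⟨M, hM⟩ := h.compact.exists_bound_of_continuousOn h.continuous.continuousOn
  obtain ⟨N, hN⟩ := h.exists_norm_bound
  have hC := h.C_nonneg
  set q : ℝ → ℝ := fun t => ‖m t‖ ^ 2 + ‖gradient F (x t)‖ ^ 2 with hq
  have hq0 : ∀ t, 0 ≤ q t := fun t => by positivity
  set W : ℝ → ℝ := fun t => e t - δ * inner ℝ (gradient F (x t)) (m t) with hWdef
  have hWF : ∀ t, 1 ≤ t → |W t - F (x t)| ≤ (C + δ) * q t := fun t ht =>
    h.abs_modified_energy_sub_le hδ.le ht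
  have hmono : ∀ s t, 1 ≤ s → s ≤ t → Q s ≤ Q t := by
    intro s t hs hst
    have hm : MonotoneOn Q (Ici 1) := by
      refine monotoneOn_of_deriv_nonneg (convex_Ici 1)
        (fun u hu => (hQ u hu).continuousAt.continuousWithinAt)
        (fun u hu => (hQ u (interior_subset hu)).differentiableAt.differentiableWithinAt)
        (fun u hu => ?_)
      rw [(hQ u (interior_subset hu)).deriv]
      exact hq0 u
    exact hm hs (hs.trans hst) hst
  have hbdd : ∀ t, 1 ≤ t → Q t ≤ Q 1 + (W 1 + M + (C + δ) * N) / κ := by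
    intro t ht
    have h1 := hW 1 t le_rfl ht
    have h2 := (abs_le.1 (hWF t ht)).1
    have h3 := neg_le_of_abs_le (hM _ (h.mem t ht))
    have h4 : (C + δ) * q t ≤ (C + δ) * N := by gcongr; exact hN t ht
    have h5 : Q t - Q 1 ≤ (W 1 + M + (C + δ) * N) / κ := by
      rw [le_div_iff₀ hκ]
      simp only [hWdef] at *
      linarith
    linarith
  -- Monotone convergence of the primitive `Q`.
  obtain ⟨Qlim, hQl⟩ : ∃ l, Tendsto Q atTop (𝓝 l) := by
    have hm : Monotone fun t => Q (max 1 t) := fun s t hst =>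
      hmono _ _ (le_max_left _ _) (max_le_max_left 1 hst)
    have hb : BddAbove (range fun t => Q (max 1 t)) :=
      ⟨_, forall_mem_range.2 fun t => hbdd _ (le_max_left 1 t)⟩
    refine ⟨_, (tendsto_atTop_ciSup hm hb).congr' ?_⟩
    filter_upwards [eventually_ge_atTop 1] with t ht
    rw [max_eq_right ht]
  have hQle : ∀ t, 1 ≤ t → Q t ≤ Qlim := fun t ht =>
    ge_of_tendsto hQl ((eventually_ge_atTop t).mono fun s hs => hmono t s ht hs)
  -- By the mean value theorem, `q` takes small values at a sequence of times `τ n → ∞`.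
  have hτ : ∀ n : ℕ, ∃ τ ∈ Ioo ((n : ℝ) + 1) (n + 2), q τ = Q (n + 2) - Q (n + 1) := by
    intro n
    have hn : (0 : ℝ) ≤ n := n.cast_nonneg
    obtain ⟨τ, hτ, he⟩ := exists_hasDerivAt_eq_slope Q q
      (show (n : ℝ) + 1 < n + 2 by linarith)
      (fun u hu => (hQ u (by linarith [hu.1])).continuousAt.continuousWithinAt)
      (fun u hu => hQ u (by linarith [hu.1]))
    refine ⟨τ, hτ, he.trans ?_⟩
    rw [show (n : ℝ) + 2 - (n + 1) = 1 by ring, div_one]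
  choose τ hτmem hτq using hτ
  have hτ1 : ∀ n, 1 ≤ τ n := fun n => by
    have hn : (0 : ℝ) ≤ n := n.cast_nonneg
    linarith [(hτmem n).1]
  have hτtop : Tendsto τ atTop atTop :=
    tendsto_atTop_mono (fun n => by linarith [(hτmem n).1]) tendsto_natCast_atTop_atTop
  have hqτ : Tendsto (fun n => q (τ n)) atTop (𝓝 0) := by
    simp_rw [hτq]
    have hshift : ∀ r : ℝ, Tendsto (fun n : ℕ => Q (n + r)) atTop (𝓝 Qlim) := fun r =>
      hQl.comp (tendsto_atTop_add_const_right _ r tendsto_natCast_atTop_atTop)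
    simpa using (hshift 2).sub (hshift 1)
  obtain ⟨y, -, φ, hφ, hy⟩ := h.compact.tendsto_subseq fun n => h.mem (τ n) (hτ1 n)
  have hτφ : Tendsto (τ ∘ φ) atTop atTop := hτtop.comp hφ.tendsto_atTop
  have hqφ : Tendsto (fun n => q (τ (φ n))) atTop (𝓝 0) := hqτ.comp hφ.tendsto_atTop
  have hcrit : gradient F y = 0 := by
    have h1 : Tendsto (fun n => ‖gradient F (x (τ (φ n)))‖ ^ 2) atTop
        (𝓝 (‖gradient F y‖ ^ 2)) :=
      (((h.continuous_gradient.tendsto y).comp hy).norm).pow 2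
    have h2 : Tendsto (fun n => ‖gradient F (x (τ (φ n)))‖ ^ 2) atTop (𝓝 0) :=
      squeeze_zero (fun n => by positivity)
        (fun n => le_add_of_nonneg_left (by positivity)) hqφ
    have h3 := tendsto_nhds_unique h1 h2
    simpa using h3
  have hWy : Tendsto (fun n => W (τ (φ n))) atTop (𝓝 (F y)) := by
    have h1 : Tendsto (fun n => W (τ (φ n)) - F (x (τ (φ n)))) atTop (𝓝 0) :=
      squeeze_zero_norm (fun n => hWF _ (hτ1 _)) (by simpa using hqφ.const_mul (C + δ))
    simpa using h1.add ((h.continuous.tendsto y).comp hy)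
  -- Passing to the limit in the dissipation estimate.
  have hWR : ∀ t, 1 ≤ t → κ * (Qlim - Q t) ≤ W t - F y := by
    intro t ht
    have h1 : Tendsto (fun n => W (τ (φ n)) + κ * (Q (τ (φ n)) - Q t)) atTop
        (𝓝 (F y + κ * (Qlim - Q t))) :=
      hWy.add (((hQl.comp hτφ).sub_const _).const_mul κ)
    have h2 : F y + κ * (Qlim - Q t) ≤ W t :=
      le_of_tendsto h1 ((hτφ.eventually_ge_atTop t).mono fun n hn => hW t _ ht hn)
    linarith
  refine ⟨fun t => Qlim - Q t + Real.exp (-(2 * t)) / 2, y, (1 + C + δ) / κ + 1, by positivity,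
    hcrit, ?_, ?_, fun t ht => ?_, fun t ht => ?_, fun t ht => ?_⟩
  · exact hy.mapClusterPt.of_comp hτφ
  · have h1 : Tendsto (fun t : ℝ => Real.exp (-(2 * t))) atTop (𝓝 0) :=
      Real.tendsto_exp_neg_atTop_nhds_zero.comp (tendsto_id.const_mul_atTop two_pos)
    simpa using (hQl.const_sub Qlim).add (h1.div_const 2)
  · refine (((hQ t ht).const_sub Qlim).add
      ((((hasDerivAt_id t).const_mul 2).neg).exp.div_const 2)).congr_deriv ?_
    simp
    ring
  · have := hQle t ht
    have := Real.exp_pos (-(2 * t))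
    linarith
  · have hE := Real.exp_pos (-(2 * t))
    have h1 : Qlim - Q t ≤ (W t - F y) / κ := by
      rw [le_div_iff₀ hκ]; linarith [hWR t ht]
    have h2 : W t - F y ≤ (1 + C + δ) * (|F (x t) - F y| + (q t + Real.exp (-(2 * t)))) := by
      have h3 := (abs_le.1 (hWF t ht)).2
      have h4 := le_abs_self (F (x t) - F y)
      have h5 := abs_nonneg (F (x t) - F y)
      have h6 := hq0 t
      nlinarith [mul_nonneg (by positivity : 0 ≤ C + δ) h5,
        mul_nonneg (by positivity : 0 ≤ 1 + C + δ) hE.le]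
    have h7 : (W t - F y) / κ ≤
        (1 + C + δ) / κ * (|F (x t) - F y| + (q t + Real.exp (-(2 * t)))) := by
      rw [div_mul_eq_mul_div]
      gcongr
    have h8 : Real.exp (-(2 * t)) / 2 ≤ |F (x t) - F y| + (q t + Real.exp (-(2 * t))) := by
      have h5 := abs_nonneg (F (x t) - F y)
      have h6 := hq0 t
      linarith
    calc Qlim - Q t + Real.exp (-(2 * t)) / 2 ≤ _ := add_le_add (h1.trans h7) h8
      _ = _ := by ring

end IsDissipative

end Dissipative

section Dissipative

/-- A Łojasiewicz inequality for `F` turns into one for the remaining dissipation. The exponent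
`θ ≤ 1 / 2` makes the quadratic terms harmless. -/
theorem rpow_one_sub_le {R D g s N B c₀ θ : ℝ} (hθ : θ ∈ Ioc (0 : ℝ) (1 / 2)) (hc₀ : 0 < c₀)
    (hB : 0 ≤ B) (hR : 0 ≤ R) (hD : 0 ≤ D) (hs : 0 ≤ s) (hsN : s ≤ N) (hgs : g ≤ √s)
    (hDg : c₀ * D ^ (1 - θ) ≤ g) (hRB : R ≤ B * (D + s)) :
    R ^ (1 - θ) ≤ B ^ (1 - θ) * (1 / c₀ + N ^ (1 / 2 - θ)) * √s := by
  have hθ1 : 0 ≤ 1 - θ := by linarith [hθ.2]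
  have h1 : D ^ (1 - θ) ≤ 1 / c₀ * √s := by
    rw [div_mul_eq_mul_div, one_mul, le_div_iff₀ hc₀]; linarith
  have h2 : s ^ (1 - θ) ≤ N ^ (1 / 2 - θ) * √s := by
    rw [show 1 - θ = (1 / 2 - θ) + 1 / 2 by ring,
      Real.rpow_add_of_nonneg hs (by linarith [hθ.2]) (by norm_num), ← Real.sqrt_eq_rpow]
    gcongr
    linarith [hθ.2]
  calc R ^ (1 - θ) ≤ (B * (D + s)) ^ (1 - θ) := Real.rpow_le_rpow hR hRB hθ1
    _ = B ^ (1 - θ) * (D + s) ^ (1 - θ) := Real.mul_rpow hB (by positivity)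
    _ ≤ B ^ (1 - θ) * (D ^ (1 - θ) + s ^ (1 - θ)) := by
        gcongr
        exact Real.rpow_add_le_add_rpow hD hs hθ1 (by linarith [hθ.1])
    _ ≤ B ^ (1 - θ) * (1 / c₀ * √s + N ^ (1 / 2 - θ) * √s) := by gcongr
    _ = _ := by ring

variable {d : ℕ} {F : Vec d → ℝ} {x x' m : ℝ → Vec d} {e e' : ℝ → ℝ} {K : Set (Vec d)}
  {a k c c₁ C L : ℝ}

theorem IsDissipative.exists_tendsto (h : IsDissipative F x x' m e e' K a k c c₁ C L)
    (hloj : LojasiewiczProperty F) :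
    ∃ y ∈ criticalSet F, Tendsto x atTop (𝓝 y) ∧ ∀ θ : ℝ, IsLojasiewiczExponent F y θ →
      (θ < 1 / 2 → ∃ C : ℝ, ∀ᶠ t in atTop, ‖x t - y‖ ≤ C * t ^ (-(θ / (1 - 2 * θ)))) ∧
      (θ = 1 / 2 → ∃ C δ : ℝ, 0 < δ ∧ ∀ᶠ t in atTop, ‖x t - y‖ ≤ C * Real.exp (-(δ * t))) := by
  obtain ⟨R, y, B, hB, hy, hclus, hR0, hRd, hRpos, hRB⟩ := h.exists_remaining_dissipation
  obtain ⟨N, hN⟩ := h.exists_norm_bound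
  have hk := h.k_nonneg
  set s : ℝ → ℝ := fun t => ‖m t‖ ^ 2 + ‖gradient F (x t)‖ ^ 2 + Real.exp (-(2 * t)) with hsdef
  have hspos : ∀ t, 0 < s t := fun t => by positivity
  set ρ : ℝ → ℝ := fun t => √(s t) with hρdef
  have hρpos : ∀ t, 0 < ρ t := fun t => Real.sqrt_pos.2 (hspos t)
  have hρsq : ∀ t, ρ t ^ 2 = s t := fun t => Real.sq_sqrt (hspos t).le
  have hRd' : ∀ t, 1 ≤ t → HasDerivAt R (-ρ t ^ 2) t := fun t ht => by
    rw [hρsq]; exact hRd t ht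
  have hx' : ∀ t, 1 ≤ t → ‖x' t‖ ≤ k * ρ t := fun t ht => by
    refine (h.norm_deriv_x t ht).trans ?_
    gcongr
    refine Real.le_sqrt_of_sq_le ?_
    have := Real.exp_pos (-(2 * t))
    have := sq_nonneg ‖gradient F (x t)‖
    simp only [hsdef]
    linarith
  have hloc : ∀ θ, IsLojasiewiczExponent F y θ → ∃ σ K₀ : ℝ, 0 < σ ∧ 0 < K₀ ∧
      ∀ t, 1 ≤ t → ‖x t - y‖ ≤ σ → R t ^ (1 - θ) ≤ K₀ * ρ t := by
    rintro θ ⟨hθ, c₀, σ, hc₀, hσ, hin⟩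
    have hN0 : 0 ≤ N := (by positivity : (0 : ℝ) ≤ _).trans (hN 1 le_rfl)
    refine ⟨σ, B ^ (1 - θ) * (1 / c₀ + (N + 1) ^ (1 / 2 - θ)), hσ, by positivity,
      fun t ht hxt => ?_⟩
    refine rpow_one_sub_le hθ hc₀ hB.le (hRpos t ht).le (abs_nonneg _) (hspos t).le ?_ ?_
      (hin _ hxt) (hRB t ht)
    · have h1 : Real.exp (-(2 * t)) ≤ 1 := Real.exp_le_one_iff.2 (by linarith)
      exact add_le_add (hN t ht) h1
    · refine Real.le_sqrt_of_sq_le ?_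
      have := Real.exp_pos (-(2 * t))
      have := sq_nonneg ‖m t‖
      simp only [hsdef]
      linarith
  have hlim : Tendsto x atTop (𝓝 y) := by
    obtain ⟨θ, hθ⟩ := hloj y hy
    obtain ⟨σ, K₀, hσ, hK₀, hin⟩ := hloc θ hθ
    exact tendsto_of_lojasiewicz h.deriv_x hx' hRd' hRpos (fun t _ => hρpos t) hk hθ.1.1 hK₀.le
      hσ hin hR0 hclus
  refine ⟨y, hy, hlim, fun θ hθ => ?_⟩
  obtain ⟨σ, K₀, hσ, hK₀, hin⟩ := hloc θ hθ
  have hθ0 := hθ.1.1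
  obtain ⟨t₀, ht₀, hball⟩ := eventually_atTop.1
    ((hlim.eventually (Metric.closedBall_mem_nhds y hσ)).and (eventually_ge_atTop (1 : ℝ))) |>.imp
    fun t₀ h => (show 1 ≤ t₀ ∧ ∀ t, t₀ ≤ t → ‖x t - y‖ ≤ σ from
      ⟨(h t₀ le_rfl).2, fun t ht => mem_closedBall_iff_norm.1 (h t ht).1⟩)
  have hin' : ∀ t, t₀ ≤ t → R t ^ (1 - θ) ≤ K₀ * ρ t := fun t ht =>
    hin t (ht₀.trans ht) (hball t ht)
  have hdist : ∀ t, t₀ ≤ t → ‖x t - y‖ ≤ k * K₀ / θ * R t ^ θ := fun t ht =>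
    norm_sub_limit_le_of_lojasiewicz (fun u hu => h.deriv_x u (ht₀.trans hu))
      (fun u hu => hx' u (ht₀.trans hu)) (fun u hu => hRd' u (ht₀.trans hu))
      (fun u hu => hRpos u (ht₀.trans hu)) (fun u _ => hρpos u) hk hθ0 hK₀.le hin' hlim ht
  have hconst : 0 ≤ k * K₀ / θ := by positivity
  constructor
  · intro hlt
    have hp : 0 < 1 - 2 * θ := by linarith
    have hp' : 0 < θ / (1 - 2 * θ) := by positivity
    refine ⟨k * K₀ / θ * ((1 - 2 * θ) / K₀ ^ 2 / 2) ^ (-(θ / (1 - 2 * θ))), ?_⟩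
    filter_upwards [eventually_ge_atTop (2 * t₀)] with t ht
    have htt : t₀ < t := by linarith
    have h1 := rpow_le_of_lojasiewicz (fun u hu => hRd' u (ht₀.trans hu))
      (fun u hu => hRpos u (ht₀.trans hu)) hK₀ hθ0 hlt hin' htt
    have h2 : (1 - 2 * θ) / K₀ ^ 2 / 2 * t ≤ (1 - 2 * θ) / K₀ ^ 2 * (t - t₀) := by
      rw [div_mul_eq_mul_div, mul_div_assoc]
      gcongr
      linarith
    have ht0 : 0 < t := by linarith
    have h3 := Real.rpow_le_rpow_of_nonpos (by positivity) h2 (neg_nonpos.2 hp'.le)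
    rw [Real.mul_rpow (by positivity) ht0.le] at h3
    rw [mul_assoc]
    exact (hdist t htt.le).trans (mul_le_mul_of_nonneg_left (h1.trans h3) hconst)
  · rintro rfl
    refine ⟨k * K₀ / (1 / 2) * (R t₀ * Real.exp (t₀ / K₀ ^ 2)) ^ (1 / 2 : ℝ), 1 / K₀ ^ 2 * (1 / 2),
      by positivity, ?_⟩
    filter_upwards [eventually_ge_atTop t₀] with t ht
    have h1 := le_exp_of_lojasiewicz (fun u hu => hRd' u (ht₀.trans hu))
      (fun u hu => hRpos u (ht₀.trans hu)) hK₀ hin' ht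
    have hRt := hRpos t (ht₀.trans ht)
    have hRt₀ := hRpos t₀ ht₀
    have h2 : R t ^ (1 / 2 : ℝ) ≤ (R t₀ * Real.exp (t₀ / K₀ ^ 2)) ^ (1 / 2 : ℝ) *
        Real.exp (-(1 / K₀ ^ 2 * (1 / 2) * t)) := by
      calc R t ^ (1 / 2 : ℝ) ≤ (R t₀ * Real.exp (-((t - t₀) / K₀ ^ 2))) ^ (1 / 2 : ℝ) := by
            gcongr
        _ = (R t₀ * Real.exp (t₀ / K₀ ^ 2) * Real.exp (-(1 / K₀ ^ 2 * t))) ^ (1 / 2 : ℝ) := by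
            rw [mul_assoc, ← Real.exp_add]; ring_nf
        _ = _ := by
            rw [Real.mul_rpow (by positivity) (by positivity),
              ← Real.exp_mul (-(1 / K₀ ^ 2 * t))]
            ring_nf
    rw [mul_assoc]
    exact (hdist t ht).trans (mul_le_mul_of_nonneg_left h2 hconst)

end Dissipative

/-! ### Trajectories of the ODE -/

/-- An eventual bound by a positive function extends to a set on which the curve is bounded and
the function is bounded below before any given time. -/
theorem exists_forall_le_mul {g w : ℝ → ℝ} {s : Set ℝ} {C : ℝ} (hw : ∀ t ∈ s, 0 < w t)
    (hg : ∀ T, ∃ M, ∀ t ∈ s, t ≤ T → g t ≤ M) (hwT : ∀ T, ∃ η > 0, ∀ t ∈ s, t ≤ T → η ≤ w t)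
    (hev : ∀ᶠ t in atTop, g t ≤ C * w t) : ∃ C', 0 < C' ∧ ∀ t ∈ s, g t ≤ C' * w t := by
  obtain ⟨T, hT⟩ := eventually_atTop.1 hev
  obtain ⟨M, hM⟩ := hg T
  obtain ⟨η, hη, hηw⟩ := hwT T
  refine ⟨|C| + |M| / η + 1, by positivity, fun t ht => ?_⟩
  have hwt := hw t ht
  have h0 : 0 ≤ |M| / η := by positivity
  rcases le_total T t with h | h
  · refine (hT t h).trans ?_
    gcongr
    have := le_abs_self C
    linarith
  · calc g t ≤ |M| := (hM t ht h).trans (le_abs_self M)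
      _ = |M| / η * η := by field_simp
      _ ≤ |M| / η * w t := by gcongr; exact hηw t ht h
      _ ≤ _ := by
        gcongr
        have := abs_nonneg C
        linarith

section Solution

variable {d : ℕ} {F : Vec d → ℝ} {S : Vec d → Vec d} {a b ε : ℝ} {x₀ : Vec d}
  {z : ℝ → Vec d × Vec d × Vec d}

namespace IsGlobalSolution

theorem le_energy (ha : 0 < a) (hε : 0 < ε) {t : ℝ} (ht : 0 < t) :
    F (z t).1 ≤ energy F a b ε z t := by
  refine le_add_of_nonneg_right (Finset.sum_nonneg fun i _ => ?_)
  have h1 := debias_pos ha ht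
  have h2 : 0 < precond b ε t ((z t).2.2 i) := hε.trans_le le_precond
  positivity

/-- From time `1` on, where the singularity of the ODE at `t = 0` plays no role, the trajectory is
bounded and the coordinates of the preconditioner stay between two positive constants. -/
theorem exists_isDissipative (hz : IsGlobalSolution F S a b ε x₀ z)
    (hF : Differentiable ℝ F) (hcoer : Coercive F)
    (hlip : ∀ K : Set (Vec d), IsCompact K → ∃ L : ℝ, 0 < L ∧ ∀ x ∈ K, ∀ y ∈ K,
      ‖gradient F x - gradient F y‖ ≤ L * ‖x - y‖)
    (hSb : ∀ K : Set (Vec d), IsCompact K → ∃ M : ℝ, ∀ x ∈ K, ∀ i, S x i ≤ M)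
    (hS : ∀ x i, 0 < S x i) (ha : 0 < a) (hb : 0 < b) (hab : b ≤ 4 * a) (hε : 0 < ε) :
    ∃ (x' : ℝ → Vec d) (e e' : ℝ → ℝ) (K : Set (Vec d)) (k c c₁ C L : ℝ),
      IsDissipative F (fun t => (z t).1) x' (fun t => (z t).2.1) e e' K a k c c₁ C L := by
  have hpos : ∀ t : ℝ, 1 ≤ t → 0 < t := fun t ht => one_pos.trans_le ht
  have hex : ∀ t : ℝ, ∃ e', 0 < t → HasDerivAt (energy F a b ε z) e' t ∧
      e' ≤ -(ε * debias a t * ‖(field F S a b ε t (z t)).1‖ ^ 2) := fun t => by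
    by_cases ht : 0 < t
    · obtain ⟨e', h⟩ := hz.exists_hasDerivAt_energy hF ha hb hab hε hS ht
      exact ⟨e', fun _ => h⟩
    · exact ⟨0, fun h => absurd h ht⟩
  choose e' he' using hex
  have hanti : AntitoneOn (energy F a b ε z) (Ici 1) := by
    refine antitoneOn_of_deriv_nonpos (convex_Ici 1)
      (fun u hu => (he' u (hpos u hu)).1.continuousAt.continuousWithinAt)
      (fun u hu => (he' u (hpos u
        (interior_subset hu))).1.differentiableAt.differentiableWithinAt)
      (fun u hu => ?_)
    have hu := hpos u (interior_subset hu)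
    rw [(he' u hu).1.deriv]
    have h1 := debias_pos ha hu
    have : 0 ≤ ε * debias a u * ‖(field F S a b ε u (z u)).1‖ ^ 2 := by positivity
    exact (he' u hu).2.trans (neg_nonpos.2 this)
  obtain ⟨r, hr⟩ : ∃ r, ∀ t, 1 ≤ t → (z t).1 ∈ Metric.closedBall (0 : Vec d) r := by
    have h1 : ∀ᶠ x in Bornology.cobounded (Vec d), energy F a b ε z 1 < F x :=
      hcoer.eventually_gt_atTop _
    have h2 : Bornology.IsBounded {x : Vec d | ¬ energy F a b ε z 1 < F x} := by
      rw [Bornology.isBounded_def]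
      simpa only [compl_def, mem_ofPred_eq, not_not] using! h1
    obtain ⟨r, hr⟩ := h2.subset_closedBall 0
    exact ⟨r, fun t ht => hr (not_lt.2
      ((le_energy ha hε (hpos t ht)).trans (hanti self_mem_Ici ht ht)))⟩
  set K := Metric.closedBall (0 : Vec d) r
  have hK : IsCompact K := isCompact_closedBall 0 r
  obtain ⟨L, hL, hLK⟩ := hlip K hK
  obtain ⟨M₀, hM₀⟩ := hSb K hK
  have hv : ∀ t, 1 ≤ t → ∀ i, (z t).2.2 i ≤ max M₀ ‖(z 1).2.2‖ := fun t ht i =>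
    hz.v_le hb one_pos (fun u hu => (hM₀ _ (hr u hu) i).trans (le_max_left _ _))
      (((Real.le_norm_self _).trans (PiLp.norm_apply_le _ i)).trans (le_max_right _ _)) ht
  set M := max M₀ ‖(z 1).2.2‖
  have hcont : Continuous (gradient F) := by
    rw [continuous_iff_continuousAt]
    intro x
    obtain ⟨L, hL, hLx⟩ := hlip (Metric.closedBall x 1) (isCompact_closedBall x 1)
    refine ContinuousOn.continuousAt ?_ (Metric.closedBall_mem_nhds x one_pos)
    refine (LipschitzOnWith.of_dist_le_mul (K := L.toNNReal) fun y hy y' hy' => ?_).continuousOn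
    rw [dist_eq_norm, dist_eq_norm, Real.coe_toNNReal _ hL.le]
    exact hLx y hy y' hy'
  -- Bounds on the effective step sizes.
  have hA₁ := debias_pos ha one_pos
  have hB₁ := debias_pos hb one_pos
  set D := ε + √((debias b 1)⁻¹ * M) with hD
  have hD0 : 0 < D := by positivity
  have hlow : ∀ t, 1 ≤ t → ∀ i, debias a 1 * ε ≤ debias a t * precond b ε t ((z t).2.2 i) :=
    fun t ht i => by
      have h1 := debias_mono ha ht
      have h2 : ε ≤ precond b ε t ((z t).2.2 i) := le_precond
      have h3 := debias_pos ha (hpos t ht)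
      gcongr
  have hup : ∀ t, 1 ≤ t → ∀ i, debias a t * precond b ε t ((z t).2.2 i) ≤ D := fun t ht i => by
    have h1 := debias_mono hb ht
    have h2 : 0 < precond b ε t ((z t).2.2 i) := hε.trans_le le_precond
    refine (mul_le_of_le_one_left h2.le (debias_le_one a t)).trans ?_
    have h3 := hv t ht i
    have h4 := hz.nonneg t (hpos t ht).le i
    unfold precond
    rw [hD]
    gcongr
  have hlow0 : 0 < debias a 1 * ε := by positivity
  have hnorm : ∀ t, ‖(field F S a b ε t (z t)).1‖ ^ 2 =
      ∑ i, (z t).2.1 i ^ 2 / (debias a t * precond b ε t ((z t).2.2 i)) ^ 2 := fun t => by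
    rw [EuclideanSpace.norm_sq_eq]
    refine Finset.sum_congr rfl fun i _ => ?_
    rw [field_apply, norm_neg, Real.norm_eq_abs, sq_abs, div_pow]
  have hm : ∀ t, ‖(z t).2.1‖ ^ 2 = ∑ i, (z t).2.1 i ^ 2 := fun t =>
    EuclideanSpace.real_norm_sq_eq _
  refine ⟨fun t => (field F S a b ε t (z t)).1, energy F a b ε z, e', K, 1 / (debias a 1 * ε),
    ε * debias a 1 / D ^ 2, 1 / (2 * a * D), 1 / (2 * a * (debias a 1 * ε)), L, ?_⟩
  exact
    { a_pos := ha
      k_nonneg := by positivity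
      c_pos := by positivity
      c₁_pos := by positivity
      C_nonneg := by positivity
      L_nonneg := hL.le
      compact := hK
      continuous := hF.continuous
      continuous_gradient := hcont
      lipschitz := hLK
      mem := hr
      deriv_x := fun t ht => hz.hasDerivAt_x (hpos t ht)
      norm_deriv_x := fun t ht => by
        refine (sq_le_sq₀ (norm_nonneg _) (by positivity)).1 ?_
        rw [hnorm, mul_pow, hm, Finset.mul_sum]
        refine Finset.sum_le_sum fun i _ => ?_
        rw [one_div, inv_pow, inv_mul_eq_div]
        have := hlow t ht i
        gcongr
      deriv_m := fun t ht => hz.hasDerivAt_m (hpos t ht)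
      deriv_e := fun t ht => (he' t (hpos t ht)).1
      deriv_e_le := fun t ht => by
        refine (he' t (hpos t ht)).2.trans (neg_le_neg ?_)
        have h1 : ‖(z t).2.1‖ ^ 2 / D ^ 2 ≤ ‖(field F S a b ε t (z t)).1‖ ^ 2 := by
          rw [hnorm, hm, Finset.sum_div]
          refine Finset.sum_le_sum fun i _ => ?_
          have h2 := hup t ht i
          have h3 := hlow0.trans_le (hlow t ht i)
          gcongr
        rw [div_mul_eq_mul_div, mul_div_assoc]
        have h2 := debias_mono ha ht
        have h3 := debias_pos ha (hpos t ht)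
        gcongr
      le_e := fun t ht => by
        unfold energy
        gcongr
        rw [hm, Finset.mul_sum]
        refine Finset.sum_le_sum fun i _ => ?_
        have h2 := hup t ht i
        have h3 := hlow0.trans_le (hlow t ht i)
        rw [one_div_mul_eq_div]
        gcongr
      e_le := fun t ht => by
        unfold energy
        gcongr
        rw [hm, Finset.mul_sum]
        refine Finset.sum_le_sum fun i _ => ?_
        have h2 := hlow t ht i
        rw [one_div_mul_eq_div]
        gcongr }

end IsGlobalSolution

end Solution

end Adam

theorem mainTheorem7 {d : ℕ} {Ω Ξ : Type*} [MeasurableSpace Ω] [MeasurableSpace Ξ]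
    (P : Measure Ω) [IsProbabilityMeasure P] (ξ : Ω → Ξ) (hξ : Measurable ξ)
    (f : Adam.Vec d → Ξ → ℝ) (hf : Adam.RegularModel P ξ f)
    (F : Adam.Vec d → ℝ) (hF : F = Adam.objective P ξ f)
    (S : Adam.Vec d → Adam.Vec d) (hS : S = Adam.secondMoment P ξ f)
    (hcoercive : Adam.Coercive F)
    (hSpos : ∀ x i, 0 < S x i)
    (α β : ℝ≥0 → Ico (0 : ℝ) 1) (a b : ℝ) (hab : Adam.Regime α β a b)
    (ε : ℝ) (hε : 0 < ε)
    (hloj : Adam.LojasiewiczProperty F)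
    (hint : interior (F '' Adam.criticalSet F) = ∅)
    (x₀ : Adam.Vec d) (z : ℝ → Adam.Vec d × Adam.Vec d × Adam.Vec d)
    (hz : Adam.IsGlobalSolution F S a b ε x₀ z) :
    ∃ y ∈ Adam.criticalSet F,
      Tendsto (fun t => (z t).1) atTop (𝓝 y) ∧
      ∀ θ : ℝ, Adam.IsLojasiewiczExponent F y θ →
        (θ < 1 / 2 → ∃ C : ℝ, 0 < C ∧
          ∀ t : ℝ, 0 < t → ‖(z t).1 - y‖ ≤ C * t ^ (-(θ / (1 - 2 * θ)))) ∧
        (θ = 1 / 2 → ∃ C δ : ℝ, 0 < C ∧ 0 < δ ∧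
          ∀ t : ℝ, 0 ≤ t → ‖(z t).1 - y‖ ≤ C * Real.exp (-(δ * t))) := by
  subst hF hS
  obtain ⟨x', e, e', K, k, c, c₁, C, L, hdiss⟩ := hz.exists_isDissipative
    (hf.differentiable_objective hξ) hcoercive (fun K hK => hf.gradient_lipschitz hξ hK)
    (fun K hK => hf.secondMoment_bounded hξ hK) hSpos hab.a_pos hab.b_pos hab.b_le hε
  obtain ⟨y, hy, hlim, hrate⟩ := hdiss.exists_tendsto hloj
  refine ⟨y, hy, hlim, fun θ hθ => ⟨fun hlt => ?_, fun heq => ?_⟩⟩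
  all_goals
    have hbdd : ∀ T, ∃ M, ∀ t ∈ Ici (0 : ℝ), t ≤ T → ‖(z t).1 - y‖ ≤ M := fun T => by
      have hc : ContinuousOn (fun t => (z t).1 - y) (Icc 0 T) :=
        (hz.continuousOn.fst.mono Icc_subset_Ici_self).sub continuousOn_const
      obtain ⟨M, hM⟩ := isCompact_Icc.exists_bound_of_continuousOn hc
      exact ⟨M, fun t ht htT => hM t ⟨ht, htT⟩⟩
  · obtain ⟨C, hC⟩ := (hrate θ hθ).1 hlt
    have hp : 0 ≤ θ / (1 - 2 * θ) := div_nonneg hθ.1.1.le (by linarith)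
    refine Adam.exists_forall_le_mul (s := Ioi 0) (fun t ht => Real.rpow_pos_of_pos ht _)
      (fun T => (hbdd T).imp fun M hM t ht => hM t (mem_Ici.2 (le_of_lt ht))) (fun T => ?_) hC
    refine ⟨max T 1 ^ (-(θ / (1 - 2 * θ))), by positivity, fun t ht htT => ?_⟩
    exact Real.rpow_le_rpow_of_nonpos ht (htT.trans (le_max_left T 1)) (neg_nonpos.2 hp)
  · obtain ⟨C, δ, hδ, hC⟩ := (hrate θ hθ).2 heq
    obtain ⟨C', hC', hle⟩ := Adam.exists_forall_le_mul (s := Ici 0)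
      (fun t _ => Real.exp_pos _) hbdd (fun T => ⟨Real.exp (-(δ * T)), Real.exp_pos _,
        fun t _ htT => by gcongr⟩) hC
    exact ⟨C', δ, hC', hδ, hle⟩
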